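/- Let $k\ge 1$ and let ${\bf n}=(n_1,\dots,n_k)$, ${\bf m}=(m_1,\dots,m_k)$ be tuples of positive integers. For each $i$ let $f_i=\sum_{\alpha\in\mathbb F_{n_i}^+}a_{i,\alpha}Z_\alpha$ be a positive regular free holomorphic function in $n_i$ noncommuting indeterminates ($\mathbb F_{n_i}^+$ is the free monoid on $g_1,\dots,g_{n_i}$ with identity $g_0$), i.e. $a_{i,\alpha}\ge0$, $a_{i,g_0}=0$, $a_{i,g_j}>0$ for all $j$, and $\limsup_{p}(\sum_{|\alpha|=p}|a_{i,\alpha}|^2)^{1/2p}<\infty$. For a tuple $X_i=(X_{i,1},\dots,X_{i,n_i})$ of bounded operators on a complex Hilbert space $\mathcal H$ put $\Phi_{f_i,X_i}(Y)=\sum_{\alpha}a_{i,\alpha}X_{i,\alpha}YX_{i,\alpha}^*$ (weak operator topology), and for ${\bf p}\in\mathbb Z_+^k$ put ${\bf\Delta}^{\bf p}_{{\bf f},{\bf X}}=(\mathrm{id}-\Phi_{f_1,X_1})^{p_1}\cdots(\mathrm{id}-\Phi_{f_k,X_k})^{p_k}$. The polydomain ${\bf D}^{\bf m}_{\bf f}(\mathcal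 H)$ consists of the tuples ${\bf X}=(X_1,\dots,X_k)$ such that the entries of $X_p$ commute with those of $X_q$ for $p\ne q$, each $\Phi_{f_i,X_i}(I)$ is well defined and $\le I$, and ${\bf\Delta}_{{\bf f},{\bf X}}^{(\epsilon_1m_1,\dots,\epsilon_km_k)}(I)\ge0$ for all $\epsilon_i\in\{0,1\}$. A tuple ${\bf T}\in{\bf D}^{\bf m}_{\bf f}(\mathcal H)$ is completely non-coisometric if there is no $h\neq0$ in $\mathcal H$ with $\langle(\mathrm{id}-\Phi_{f_1,T_1}^{q_1})\cdots(\mathrm{id}-\Phi_{f_k,T_k}^{q_k})(I)h,h\rangle=0$ for all positive integers $q_1,\dots,q_k$. Put $b_{i,g_0}=1$ and, for $|\alpha|\ge1$, $b_{i,\alpha}=\sum_{p=1}^{|\alpha|}\sum_{\gamma_1\cdots\gamma_p=\alpha,\,|\gamma_s|\ge1}a_{i,\gamma_1}\cdots a_{i,\gamma_p}\binom{p+m_i-1}{m_i-1}$. Let $\mathcal F=F^2(H_{n_1})\otimes\cdots\otimes F^2(H_{n_k})$ be the Hilbert tensor product of full Fock spaces, with orthonormal basis $e_\beta=e^1_{\beta_1}\otimes\cdots\otimes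 e^k_{\beta_k}$, $\beta_i\in\mathbb F_{n_i}^+$, and let ${\bf W}_{i,j}\in B(\mathcal F)$ act in the $i$-th factor by $e^i_\alpha\mapsto\sqrt{b_{i,\alpha}/b_{i,g_j\alpha}}\;e^i_{g_j\alpha}$ and as the identity in the others. A bounded operator $M:\mathcal F\otimes\mathcal E\to\mathcal F\otimes\mathcal G$ is multi-analytic if $M({\bf W}_{i,j}\otimes I_{\mathcal E})=({\bf W}_{i,j}\otimes I_{\mathcal G})M$ for all $i,j$. Two multi-analytic operators $\Theta:\mathcal F\otimes\mathcal E\to\mathcal F\otimes\mathcal G$ and $\Theta':\mathcal F\otimes\mathcal E'\to\mathcal F\otimes\mathcal G'$ coincide if there are unitary operators $\tau_1:\mathcal E\to\mathcal E'$ and $\tau_2:\mathcal G\to\mathcal G'$ with $\Theta'(I_{\mathcal F}\otimes\tau_1)=(I_{\mathcal F}\otimes\tau_2)\Theta$. For ${\bf T}\in{\bf D}^{\bf m}_{\bf f}(\mathcal H)$ let $\mathcal D_{\bf T}=\overline{{\bf\Delta}^{\bf m}_{{\bf f},{\bf T}}(I)\mathcal H}$ and let ${\bf K}_{{\bf f},{\bf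 T}}:\mathcal H\to\mathcal F\otimes\mathcal D_{\bf T}$ be the (bounded) Berezin kernel $${\bf K}_{{\bf f},{\bf T}}h=\sum_{\beta}\sqrt{b_{1,\beta_1}}\cdots\sqrt{b_{k,\beta_k}}\;e_\beta\otimes{\bf\Delta}^{\bf m}_{{\bf f},{\bf T}}(I)^{1/2}T_{1,\beta_1}^*\cdots T_{k,\beta_k}^*h .$$ ${\bf T}$ admits a characteristic function if there are a Hilbert space $\mathcal E$ and a multi-analytic operator $\Psi:\mathcal F\otimes\mathcal E\to\mathcal F\otimes\mathcal D_{\bf T}$ with ${\bf K}_{{\bf f},{\bf T}}{\bf K}_{{\bf f},{\bf T}}^*+\Psi\Psi^*=I$. In this case let $Y=I-{\bf K}_{{\bf f},{\bf T}}{\bf K}_{{\bf f},{\bf T}}^*$ and $\mathcal M_{\bf T}=\overline{\operatorname{range}Y}$, and let ${\bf M}_{\bf T}=(M_{i,j})\in{\bf D}_{\bf f}^{\bf m}(\mathcal M_{\bf T})$ be the tuple with $M_{i,j}=A_{i,j}^*$, where $A_{i,j}\in B(\mathcal M_{\bf T})$ is determined by $A_{i,j}Y^{1/2}x=Y^{1/2}({\bf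 W}_{i,j}^*\otimes I)x$ for all $x\in\mathcal F\otimes\mathcal D_{\bf T}$. The characteristic function of ${\bf T}$ is $$\Theta_{{\bf f},{\bf T}}=Y^{1/2}\,{\bf K}_{{\bf f},{\bf M}_{\bf T}}^*:\ \mathcal F\otimes\mathcal D_{{\bf M}_{\bf T}}\to\mathcal F\otimes\mathcal D_{\bf T},\qquad \mathcal D_{{\bf M}_{\bf T}}=\overline{{\bf\Delta}^{\bf m}_{{\bf f},{\bf M}_{\bf T}}(I)\mathcal M_{\bf T}} .$$ **Theorem.** Let ${\bf T}\in{\bf D}^{\bf m}_{\bf f}(\mathcal H)$ and ${\bf T}'\in{\bf D}^{\bf m}_{\bf f}(\mathcal H')$ be completely non-coisometric tuples that admit characteristic functions. Then ${\bf T}$ and ${\bf T}'$ are unitarily equivalent, i.e. there is a unitary operator $U:\mathcal H\to\mathcal H'$ with $UT_{i,j}=T'_{i,j}U$ for all $i,j$, if and only if their characteristic functions $\Theta_{{\bf f},{\bf T}}$ and $\Theta_{{\bf f},{\bf T}'}$ coincide. -/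

import Mathlib

open scoped ENNReal InnerProductSpace

noncomputable section

namespace Polydomain

/-! ### Positive regular free holomorphic functions and the coefficients `b_α^{(m)}` -/

/-- A positive regular free holomorphic function in a neighbourhood of the origin: a formal power
series `∑ a_α Z_α` in `n` noncommuting indeterminates with `a_α ≥ 0`, zero constant term, strictly
positive linear coefficients and `limsup_p (∑_{|α| = p} |a_α|²)^{1/(2p)} < ∞`. -/
structure PositiveRegular (n : ℕ) where
  /-- the coefficients `a_α` -/
  coeff : FreeMonoid (Fin n) → ℝ
  coeff_nonneg : ∀ α, 0 ≤ coeff α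
  coeff_one : coeff 1 = 0
  coeff_of_pos : ∀ j, 0 < coeff (FreeMonoid.of j)
  limsup_lt_top : Filter.limsup (fun p : ℕ => ENNReal.ofReal
    ((∑ w : Fin p → Fin n, |coeff (FreeMonoid.ofList (List.ofFn w))| ^ 2) ^
      ((1 : ℝ) / (2 * (p : ℝ))))) Filter.atTop < ⊤

namespace PositiveRegular

variable {n : ℕ}

/-- The coefficient `b_α^{(m)} = ∑_p ∑_{γ₁⋯γ_p = α, |γ_s| ≥ 1} a_{γ₁} ⋯ a_{γ_p} C(p+m-1, m-1)`.
The factorizations of the word `α` into `p` nonempty words are its splittings along the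
compositions of the integer `|α|` with `p` parts.  For the empty word only the empty factorization
occurs, and the value is `1`, see `b_one`. -/
def b (f : PositiveRegular n) (m : ℕ) (α : FreeMonoid (Fin n)) : ℝ :=
  ∑ c : Composition α.toList.length,
    ((α.toList.splitWrtComposition c).map fun γ => f.coeff (FreeMonoid.ofList γ)).prod *
      ((c.length + m - 1).choose (m - 1) : ℝ)

theorem b_one (f : PositiveRegular n) (m : ℕ) : f.b m 1 = 1 := by
  have hs : Subsingleton (Composition (FreeMonoid.toList (1 : FreeMonoid (Fin n))).length) :=
    Fintype.card_le_one_iff_subsingleton.mp (composition_card 0).le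
  rw [b, Fintype.sum_subsingleton _ (Composition.ones _)]
  simp [List.splitWrtComposition, List.splitWrtCompositionAux, Composition.length]

theorem prod_coeff_nonneg (f : PositiveRegular n) (l : List (List (Fin n))) :
    0 ≤ (l.map fun γ => f.coeff (FreeMonoid.ofList γ)).prod :=
  List.prod_nonneg (by simpa using fun a _ => f.coeff_nonneg (FreeMonoid.ofList a))

theorem b_nonneg (f : PositiveRegular n) (m : ℕ) (α : FreeMonoid (Fin n)) : 0 ≤ f.b m α :=
  Finset.sum_nonneg fun _ _ => mul_nonneg (f.prod_coeff_nonneg _) (Nat.cast_nonneg _)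

/-- Splitting off a first letter: `a_{g_j} b_γ ≤ b_{g_j γ}`. -/
theorem coeff_mul_b_le (f : PositiveRegular n) (m : ℕ) (j : Fin n) (γ : FreeMonoid (Fin n)) :
    f.coeff (FreeMonoid.of j) * f.b m γ ≤ f.b m (FreeMonoid.of j * γ) := by
  let e : Composition γ.toList.length →
      Composition (FreeMonoid.toList (FreeMonoid.of j * γ)).length := fun c =>
    ⟨1 :: c.blocks, by
      intro i hi
      rcases List.mem_cons.mp hi with rfl | h
      · exact one_pos
      · exact c.blocks_pos h, by simp [c.blocks_sum, add_comm]⟩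
  have he : Function.Injective e := fun c d h => by
    have := congrArg Composition.blocks h
    exact Composition.ext (List.cons.inj this).2
  rw [b, b, Finset.mul_sum]
  refine le_trans ?_ (Finset.sum_le_univ_sum_of_nonneg (s := Finset.univ.map ⟨e, he⟩)
    fun c => mul_nonneg (f.prod_coeff_nonneg _) (Nat.cast_nonneg _))
  rw [Finset.sum_map]
  refine Finset.sum_le_sum fun c _ => ?_
  have h1 : (FreeMonoid.toList (FreeMonoid.of j * γ)).splitWrtComposition (e c) =
      [j] :: γ.toList.splitWrtComposition c := by
    simp [List.splitWrtComposition, e, List.splitWrtCompositionAux_cons]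
  have h2 : (e c).length = c.length + 1 := by simp [e, Composition.length]
  simp only [Function.Embedding.coeFn_mk]
  rw [h1, h2, List.map_cons, List.prod_cons, ← mul_assoc]
  have h3 : FreeMonoid.ofList [j] = FreeMonoid.of j := rfl
  rw [h3]
  refine mul_le_mul_of_nonneg_left ?_ (mul_nonneg (f.coeff_nonneg _) (f.prod_coeff_nonneg _))
  exact_mod_cast Nat.choose_le_choose _ (by omega)

/-- The weights of the shift `W_{i,j}` are bounded. -/
theorem weight_le (f : PositiveRegular n) (m : ℕ) (j : Fin n) (γ : FreeMonoid (Fin n)) :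
    |√(f.b m γ) / √(f.b m (FreeMonoid.of j * γ))| ≤ √(1 / f.coeff (FreeMonoid.of j)) := by
  rw [abs_of_nonneg (by positivity), ← Real.sqrt_div (f.b_nonneg m γ)]
  refine Real.sqrt_le_sqrt ?_
  have ha := f.coeff_of_pos j
  have h := f.coeff_mul_b_le m j γ
  rcases (f.b_nonneg m (FreeMonoid.of j * γ)).eq_or_lt with h0 | h0
  · rw [← h0, div_zero]; positivity
  · rw [div_le_div_iff₀ h0 ha]; linarith

end PositiveRegular

/-! ### The Hilbert space `F²(H_{n₁}) ⊗ ⋯ ⊗ F²(H_{n_k}) ⊗ D` -/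

/-- The set `𝔽_{n₁}⁺ × ⋯ × 𝔽_{n_k}⁺` of multi-words. -/
abbrev Words {k : ℕ} (n : Fin k → ℕ) : Type := ∀ i, FreeMonoid (Fin (n i))

/-- The Hilbert space `F²(H_{n₁}) ⊗ ⋯ ⊗ F²(H_{n_k}) ⊗ D`.  Since the vectors
`e_β = e¹_{β₁} ⊗ ⋯ ⊗ e^k_{β_k}` are an orthonormal basis of the product of the Fock spaces, its
elements are the sums `∑_β e_β ⊗ h_β` with `h_β ∈ D` and `∑_β ‖h_β‖² < ∞`. -/
abbrev Fock {k : ℕ} (n : Fin k → ℕ) (D : Type*) [NormedAddCommGroup D] :=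
  lp (fun _ : Words n => D) 2

section operators

variable {ι D D' : Type*} [NormedAddCommGroup D] [NormedAddCommGroup D']

theorem hasSum_sq (x : lp (fun _ : ι => D) 2) : HasSum (fun i => ‖x i‖ ^ 2) (‖x‖ ^ 2) := by
  simpa using lp.hasSum_norm (p := 2) (by simp) x

theorem memℓp_two {x : ι → D} (h : Summable fun i => ‖x i‖ ^ 2) :
    Memℓp (E := fun _ : ι => D) x 2 :=
  memℓp_gen (by simpa using h)

theorem norm_extend {s : ι → ι} (hs : Function.Injective s) (u : ι → D) :
    (fun α => ‖Function.extend s u 0 α‖ ^ 2) = Function.extend s (fun β => ‖u β‖ ^ 2) 0 := by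
  funext α
  by_cases h : ∃ β, s β = α
  · obtain ⟨β, rfl⟩ := h
    simp [hs.extend_apply]
  · simp [Function.extend_apply' _ _ _ h]

variable [InnerProductSpace ℂ D] [InnerProductSpace ℂ D']

theorem hasSum_shift {s : ι → ι} (hs : Function.Injective s) {c : ι → ℝ} {C : ℝ}
    (hc : ∀ β, |c β| ≤ C) (x : lp (fun _ : ι => D) 2) :
    ∃ S ≤ C ^ 2 * ‖x‖ ^ 2,
      HasSum (fun α => ‖Function.extend s (fun β => (c β : ℂ) • x β) 0 α‖ ^ 2) S := by
  have bd : ∀ β, ‖(c β : ℂ) • x β‖ ^ 2 ≤ C ^ 2 * ‖x β‖ ^ 2 := by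
    intro β
    rw [norm_smul, mul_pow, Complex.norm_real, Real.norm_eq_abs]
    gcongr
    exact hc β
  have hx := (hasSum_sq x).mul_left (C ^ 2)
  have sm : Summable fun β => ‖(c β : ℂ) • x β‖ ^ 2 :=
    Summable.of_nonneg_of_le (fun _ => by positivity) bd hx.summable
  refine ⟨_, hasSum_le bd sm.hasSum hx, ?_⟩
  rw [norm_extend hs, hasSum_extend_zero hs]
  exact sm.hasSum

theorem norm_le_of_hasSum_shift {s : ι → ι} (hs : Function.Injective s) {c : ι → ℝ} {C : ℝ}
    (hc : ∀ β, |c β| ≤ C) (x y : lp (fun _ : ι => D) 2)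
    (hy : (y : ι → D) = Function.extend s (fun β => (c β : ℂ) • x β) 0) : ‖y‖ ≤ |C| * ‖x‖ := by
  obtain ⟨S, hS, hsum⟩ := hasSum_shift hs hc x
  refine (sq_le_sq₀ (norm_nonneg _) (by positivity)).mp ?_
  rw [mul_pow, sq_abs]
  have h := hasSum_sq y
  rw [hy] at h
  exact (h.unique hsum).trans_le hS

theorem extend_add {s : ι → ι} (hs : Function.Injective s) (c : ι → ℝ) (x y : ι → D) :
    Function.extend s (fun β => (c β : ℂ) • (x + y) β) 0 =
      Function.extend s (fun β => (c β : ℂ) • x β) 0 +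
        Function.extend s (fun β => (c β : ℂ) • y β) 0 := by
  funext α
  by_cases h : ∃ β, s β = α
  · obtain ⟨β, rfl⟩ := h
    simp only [hs.extend_apply, Pi.add_apply, smul_add]
  · simp only [Function.extend_apply' _ _ _ h, Pi.add_apply, Pi.zero_apply, add_zero]

theorem extend_smul {s : ι → ι} (hs : Function.Injective s) (c : ι → ℝ) (r : ℂ) (x : ι → D) :
    Function.extend s (fun β => (c β : ℂ) • (r • x) β) 0 =
      r • Function.extend s (fun β => (c β : ℂ) • x β) 0 := by
  funext α
  by_cases h : ∃ β, s β = α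
  · obtain ⟨β, rfl⟩ := h
    simp only [hs.extend_apply, Pi.smul_apply, smul_comm r]
  · simp only [Function.extend_apply' _ _ _ h, Pi.smul_apply, Pi.zero_apply, smul_zero]

/-- The bounded operator on `ℓ²(ι; D)` with `e_β ⊗ h ↦ c_β e_{s β} ⊗ h`, for an injective map `s`
and bounded weights `c`. -/
def weightedShift (D : Type*) [NormedAddCommGroup D] [InnerProductSpace ℂ D]
    (s : ι → ι) (hs : Function.Injective s) (c : ι → ℝ) (C : ℝ) (hc : ∀ β, |c β| ≤ C) :
    lp (fun _ : ι => D) 2 →L[ℂ] lp (fun _ : ι => D) 2 :=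
  LinearMap.mkContinuous
    { toFun := fun x => ⟨Function.extend s (fun β => (c β : ℂ) • x β) 0,
        memℓp_two (hasSum_shift hs hc x).choose_spec.2.summable⟩
      map_add' := fun x y => Subtype.ext (extend_add hs c x y)
      map_smul' := fun r x => Subtype.ext (extend_smul hs c r x) }
    |C| fun x => norm_le_of_hasSum_shift hs hc x _ rfl

theorem weightedShift_apply (s : ι → ι) (hs : Function.Injective s) (c : ι → ℝ) (C : ℝ)
    (hc : ∀ β, |c β| ≤ C) (x : lp (fun _ : ι => D) 2) (β : ι) :
    weightedShift D s hs c C hc x (s β) = (c β : ℂ) • x β :=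
  hs.extend_apply (fun β => (c β : ℂ) • x β) 0 β

/-- The isometry `I ⊗ τ : ∑_β e_β ⊗ h_β ↦ ∑_β e_β ⊗ τ h_β` for a unitary `τ : D → D'`. -/
def idTensor (ι : Type*) (τ : D ≃ₗᵢ[ℂ] D') :
    lp (fun _ : ι => D) 2 →ₗᵢ[ℂ] lp (fun _ : ι => D') 2 where
  toFun x := ⟨fun β => τ (x β), memℓp_two (by simpa using (hasSum_sq x).summable)⟩
  map_add' x y := Subtype.ext (funext fun β => map_add τ (x β) (y β))
  map_smul' r x := Subtype.ext (funext fun β => map_smul τ r (x β))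
  norm_map' x := by
    refine (sq_eq_sq₀ (norm_nonneg _) (norm_nonneg _)).mp ?_
    refine (hasSum_sq _).unique ?_
    simpa using hasSum_sq x

end operators

section universalModel

variable {k : ℕ} {n : Fin k → ℕ}

/-- Left multiplication of the `i`-th word by the letter `g_j`. -/
def consWord (i : Fin k) (j : Fin (n i)) (β : Words n) : Words n :=
  Function.update β i (FreeMonoid.of j * β i)

theorem consWord_injective (i : Fin k) (j : Fin (n i)) :
    Function.Injective (consWord (n := n) i j) := by
  intro β γ h
  funext l
  have hl := congrFun h l
  by_cases hli : l = i
  · subst hli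
    simpa [consWord] using hl
  · simpa [consWord, hli] using hl

/-- The operator `𝐖_{i,j} ⊗ I_D`, where `𝐖` is the universal model: the weighted left creation
operator `e_α ↦ √b_α / √b_{g_j α} · e_{g_j α}` in the `i`-th tensor factor and the identity in
all the others. -/
def universalModel (f : ∀ i, PositiveRegular (n i)) (m : Fin k → ℕ) (D : Type*)
    [NormedAddCommGroup D] [InnerProductSpace ℂ D] (i : Fin k) (j : Fin (n i)) :
    Fock n D →L[ℂ] Fock n D :=
  weightedShift D (consWord i j) (consWord_injective i j)
    (fun β => √((f i).b (m i) (β i)) / √((f i).b (m i) (FreeMonoid.of j * β i)))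
    (√(1 / (f i).coeff (FreeMonoid.of j))) fun β => (f i).weight_le (m i) j (β i)

/-- Multi-analytic operators `M : (⊗ F²(H_{n_i})) ⊗ D → (⊗ F²(H_{n_i})) ⊗ D'` with respect
to `𝐖`. -/
def IsMultiAnalytic (f : ∀ i, PositiveRegular (n i)) (m : Fin k → ℕ) {D D' : Type*}
    [NormedAddCommGroup D] [InnerProductSpace ℂ D]
    [NormedAddCommGroup D'] [InnerProductSpace ℂ D'] (M : Fock n D →L[ℂ] Fock n D') : Prop :=
  ∀ i j, M ∘L universalModel f m D i j = universalModel f m D' i j ∘L M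

/-- Two multi-analytic operators coincide if they agree up to unitary changes of the coefficient
spaces: `Φ' (I ⊗ τ₁) = (I ⊗ τ₂) Φ` with unitary operators `τ₁`, `τ₂`. -/
def Coincide {K₁ K₂ K₁' K₂' : Type*}
    [NormedAddCommGroup K₁] [InnerProductSpace ℂ K₁] [NormedAddCommGroup K₂]
    [InnerProductSpace ℂ K₂] [NormedAddCommGroup K₁'] [InnerProductSpace ℂ K₁']
    [NormedAddCommGroup K₂'] [InnerProductSpace ℂ K₂']
    (Φ : Fock n K₁ →L[ℂ] Fock n K₂) (Φ' : Fock n K₁' →L[ℂ] Fock n K₂') : Prop :=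
  ∃ (τ₁ : K₁ ≃ₗᵢ[ℂ] K₁') (τ₂ : K₂ ≃ₗᵢ[ℂ] K₂'),
    ∀ x, Φ' (idTensor (Words n) τ₁ x) = idTensor (Words n) τ₂ (Φ x)

end universalModel

/-! ### The noncommutative polydomain -/

section polydomain

variable {k : ℕ} {n : Fin k → ℕ} {H : Type*} [NormedAddCommGroup H] [InnerProductSpace ℂ H]

/-- Tuples `X = (X_1, …, X_k)` of tuples `X_i = (X_{i,1}, …, X_{i,n_i})` of bounded operators. -/
abbrev OpTuple (n : Fin k → ℕ) (H : Type*) [NormedAddCommGroup H] [InnerProductSpace ℂ H] :=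
  ∀ i, Fin (n i) → (H →L[ℂ] H)

/-- Unitary equivalence of tuples of operators. -/
def UnitarilyEquivalent {H' : Type*} [NormedAddCommGroup H'] [InnerProductSpace ℂ H']
    (T : OpTuple n H) (T' : OpTuple n H') : Prop :=
  ∃ U : H ≃ₗᵢ[ℂ] H', ∀ i j h, U (T i j h) = T' i j (U h)

variable [CompleteSpace H]

/-- The square root of a positive operator. -/
def posSqrt (A : H →L[ℂ] H) : H →L[ℂ] H := CFC.sqrt A

/-- The term `a_α X_α Y X_α^*`, in the weak operator topology. -/
def phiTerm {N : ℕ} (f : PositiveRegular N) (X : Fin N → (H →L[ℂ] H)) (Y : H →L[ℂ] H)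
    (α : FreeMonoid (Fin N)) : H →WOT[ℂ] H :=
  .ofCLM ((f.coeff α : ℂ) • (FreeMonoid.lift X α * Y * star (FreeMonoid.lift X α)))

/-- The map `Φ_{f,X}(Y) = ∑_α a_α X_α Y X_α^*`, the series being taken in the weak operator
topology.  If it converges for `Y = I`, which membership in the polydomain demands, then it
converges unconditionally for all `Y`. -/
def phi {N : ℕ} (f : PositiveRegular N) (X : Fin N → (H →L[ℂ] H)) (Y : H →L[ℂ] H) :
    H →L[ℂ] H :=
  (∑' α, phiTerm f X Y α).toCLM

/-- The composition `g_1 ∘ ⋯ ∘ g_k`. -/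
def compAll {A : Type*} (g : Fin k → A → A) : A → A :=
  (List.ofFn g).foldr (· ∘ ·) id

/-- The defect mapping `Δ^p = (id - Φ_{f_1,X_1})^{p_1} ∘ ⋯ ∘ (id - Φ_{f_k,X_k})^{p_k}`. -/
def defect (f : ∀ i, PositiveRegular (n i)) (p : Fin k → ℕ) (X : OpTuple n H) :
    (H →L[ℂ] H) → (H →L[ℂ] H) :=
  compAll fun i => (fun Y => Y - phi (f i) (X i) Y)^[p i]

/-- The map `(id - Φ_{f_1,X_1}^{q_1}) ∘ ⋯ ∘ (id - Φ_{f_k,X_k}^{q_k})`. -/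
def powerDefect (f : ∀ i, PositiveRegular (n i)) (q : Fin k → ℕ) (X : OpTuple n H) :
    (H →L[ℂ] H) → (H →L[ℂ] H) :=
  compAll fun i Y => Y - (phi (f i) (X i))^[q i] Y

/-- The noncommutative polydomain `𝐃_f^m(H)`; the inequalities are those of the Loewner order. -/
structure MemPolydomain (f : ∀ i, PositiveRegular (n i)) (m : Fin k → ℕ) (X : OpTuple n H) :
    Prop where
  commute : ∀ p q, p ≠ q → ∀ s t, Commute (X p s) (X q t)
  summable : ∀ i, Summable (phiTerm (f i) (X i) 1)
  phi_le : ∀ i, phi (f i) (X i) 1 ≤ 1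
  defect_nonneg : ∀ ε : Fin k → Fin 2, 0 ≤ defect f (fun i => (ε i : ℕ) * m i) X 1

/-- Completely non-coisometric tuples in the polydomain. -/
def CompletelyNonCoisometric (f : ∀ i, PositiveRegular (n i)) (m : Fin k → ℕ) (T : OpTuple n H) :
    Prop :=
  MemPolydomain f m T ∧
    ¬ ∃ h : H, h ≠ 0 ∧ ∀ q : Fin k → ℕ, (∀ i, 1 ≤ q i) → ⟪powerDefect f q T 1 h, h⟫_ℂ = 0

/-! ### The noncommutative Berezin kernel and the characteristic function -/

/-- The closure of the range of an operator. -/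
def closedRange {E : Type*} [NormedAddCommGroup E] [InnerProductSpace ℂ E] (A : E →L[ℂ] E) :
    Submodule ℂ E :=
  (LinearMap.range (A : E →ₗ[ℂ] E)).topologicalClosure

instance {E : Type*} [NormedAddCommGroup E] [InnerProductSpace ℂ E] [CompleteSpace E]
    (A : E →L[ℂ] E) : CompleteSpace (closedRange A) :=
  Submodule.topologicalClosure.completeSpace _

/-- The space `closure (Δ^m(I) H)`. -/
abbrev defectSpace (f : ∀ i, PositiveRegular (n i)) (m : Fin k → ℕ) (T : OpTuple n H) :
    Submodule ℂ H :=
  closedRange (defect f m T 1)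

/-- `K` is the operator `h ↦ ∑_β √b_{1,β_1} ⋯ √b_{k,β_k} e_β ⊗ Δ^m(I)^{1/2} T_{1,β_1}^* ⋯
T_{k,β_k}^* h` from `H` to `(⊗ F²(H_{n_i})) ⊗ closure (Δ^m(I) H)`. -/
def IsBerezinKernel (f : ∀ i, PositiveRegular (n i)) (m : Fin k → ℕ) (T : OpTuple n H)
    (K : H →L[ℂ] Fock n (defectSpace f m T)) : Prop :=
  ∀ h β, (K h β : H) = ((∏ i, √((f i).b (m i) (β i)) : ℝ) : ℂ) •
    posSqrt (defect f m T 1) ((List.ofFn fun i => star (FreeMonoid.lift (T i) (β i))).prod h)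

open Classical in
/-- The noncommutative Berezin kernel `K_{f,T}`.  An operator as in `IsBerezinKernel` is unique, and
it exists for every `T` in the polydomain. -/
def berezinKernel (f : ∀ i, PositiveRegular (n i)) (m : Fin k → ℕ) (T : OpTuple n H) :
    H →L[ℂ] Fock n (defectSpace f m T) :=
  if h : ∃ K, IsBerezinKernel f m T K then h.choose else 0

/-- `T` belongs to the polydomain and has a characteristic function: there are a Hilbert space `E`
and a multi-analytic operator `Ψ` with coefficient spaces `E` and `closure (Δ^m(I) H)` such that
`K K^* + Ψ Ψ^* = I`. -/
def HasCharacteristicFunction.{u} {H : Type u} [NormedAddCommGroup H] [InnerProductSpace ℂ H]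
    [CompleteSpace H] (f : ∀ i, PositiveRegular (n i)) (m : Fin k → ℕ) (T : OpTuple n H) : Prop :=
  MemPolydomain f m T ∧
    ∃ (E : Type u) (_ : NormedAddCommGroup E) (_ : InnerProductSpace ℂ E) (_ : CompleteSpace E)
      (Ψ : Fock n E →L[ℂ] Fock n (defectSpace f m T)), IsMultiAnalytic f m Ψ ∧
        berezinKernel f m T ∘L (berezinKernel f m T).adjoint + Ψ ∘L Ψ.adjoint = 1

/-- The operator `I - K K^*`. -/
def complementary (f : ∀ i, PositiveRegular (n i)) (m : Fin k → ℕ) (T : OpTuple n H) :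
    Fock n (defectSpace f m T) →L[ℂ] Fock n (defectSpace f m T) :=
  1 - berezinKernel f m T ∘L (berezinKernel f m T).adjoint

/-- The space `M_T = closure (range (I - K K^*))`. -/
abbrev modelSpace (f : ∀ i, PositiveRegular (n i)) (m : Fin k → ℕ) (T : OpTuple n H) :
    Submodule ℂ (Fock n (defectSpace f m T)) :=
  closedRange (complementary f m T)

/-- `M` is the tuple of the operators `M_{i,j} = A_{i,j}^*` on `M_T`, where `A_{i,j}` is given by
`A_{i,j} ((I - K K^*)^{1/2} x) = (I - K K^*)^{1/2} (𝐖_{i,j}^* ⊗ I) x`. -/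
def IsModelTuple (f : ∀ i, PositiveRegular (n i)) (m : Fin k → ℕ) (T : OpTuple n H)
    (M : OpTuple n (modelSpace f m T)) : Prop :=
  ∀ i j, ∀ x : Fock n (defectSpace f m T), ∀ y : modelSpace f m T,
    (y : Fock n (defectSpace f m T)) = posSqrt (complementary f m T) x →
    ((M i j).adjoint y : Fock n (defectSpace f m T)) =
      posSqrt (complementary f m T) ((universalModel f m (defectSpace f m T) i j).adjoint x)

open Classical in
/-- The tuple `𝐌_T`.  A tuple as in `IsModelTuple` is unique, and it exists for every `T` that has
a characteristic function. -/
def modelTuple (f : ∀ i, PositiveRegular (n i)) (m : Fin k → ℕ) (T : OpTuple n H) :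
    OpTuple n (modelSpace f m T) :=
  if h : ∃ M, IsModelTuple f m T M then h.choose else 0

/-- The characteristic function `Θ_{f,T} = (I - K_{f,T} K_{f,T}^*)^{1/2} K_{f,𝐌_T}^*`, with the
coefficient spaces `closure (Δ_{f,𝐌_T}^m(I) M_T)` and `closure (Δ_{f,T}^m(I) H)`. -/
def characteristicFunction (f : ∀ i, PositiveRegular (n i)) (m : Fin k → ℕ) (T : OpTuple n H) :
    Fock n (defectSpace f m (modelTuple f m T)) →L[ℂ] Fock n (defectSpace f m T) :=
  (posSqrt (complementary f m T) ∘L (modelSpace f m T).subtypeL) ∘L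
    ContinuousLinearMap.adjoint (berezinKernel f m (modelTuple f m T))

end polydomain

end Polydomain

end

/-!
The proof rests on two relations. Write `W` for the universal model, `K` for the Berezin kernel of
`T`, `Y = I - K K^*` and `Q = Y^{1/2}`, regarded as an operator into `M_T`, so that `Q^* Q = Y`. The
characteristic function is `Θ = Q^* K_M^*`, where `K_M` is the Berezin kernel of the model tuple
`M`.

*The kernel of the model tuple is an isometry.* The model tuple satisfies `M^* Q = Q W^*`, and a
multi-analytic `Ψ` with `Q^* Q = Ψ Ψ^*` gives `Q^* Δ_M(I) Q = Δ_W(Q^* Q) = Ψ Δ_W(I) Ψ^*`. Since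
`Δ_W(I)` is the projection onto the vacuum space (`inner_defect_universalModel`; this is the
identity `(1 - f)^m (1 - f)^{-m} = 1` for the coefficients `b_α`), the `e_β`-component of `K_M Q x` has
the same norm as that of `Ψ^* x`. Hence `‖K_M Q x‖ = ‖Ψ^* x‖ = ‖Q x‖`
(`ModelFactorization.norm_berezinKernel`), and therefore `‖Θ^* x‖² + ‖K^* x‖² = ‖x‖²`.

*The kernel of a completely non-coisometric tuple is injective.* If `K h = 0`, then all the numbers
`⟨Φ_1^{s_1} ⋯ Φ_k^{s_k} Δ^m(I) h, h⟩` vanish. For commuting contractions `Φ_i` the exponents `m_i`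
can then be lowered to `1` one at a time: a sequence with vanishing differences and bounded partial
sums is zero. Summing, `⟨∏ (id - Φ_i^{q_i})(I) h, h⟩ = 0` for all `q`, so `h = 0`
(`CompletelyNonCoisometric.berezinKernel_injective`).

If `Θ` and `Θ'` coincide through `τ₁` and `τ₂`, the first relation yields
`‖K'^* (I ⊗ τ₂) x‖ = ‖K^* x‖`. By the second, `K^*` and `K'^*` have dense ranges, so
`K^* x ↦ K'^* (I ⊗ τ₂) x` extends to a unitary operator, and it intertwines `T` and `T'` because
`T K^* = K^* W` (`IsBerezinKernel.apply_adjoint`). Conversely, a unitary equivalence of `T` and `T'`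
carries `K` to `K'`, hence `Q` to `Q'`, hence `M` to `M'` and `K_M` to `K_{M'}`
(`exists_berezinKernel_unitary`, `IsIsometricModel.exists_unitary`), and so `Θ` to `Θ'`.

That the Berezin kernel exists for every tuple in the polydomain is `MemPolydomain.isBerezinKernel`:
the truncated series of `∏ (id - Φ_i)^{-m_i}`, applied to `Δ^m(I)`, stays below `I`
(`prod_invPartial_le`).
-/

noncomputable section

namespace Polydomain

open scoped ComplexOrder

/-! ### Operators into `ℓ²` and series in the weak operator topology -/

section columns

variable {ι H D : Type*} [NormedAddCommGroup H] [InnerProductSpace ℂ H]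
  [NormedAddCommGroup D] [InnerProductSpace ℂ D]

/-- A family of operators whose squares are uniformly summable on the unit ball is the family of
entries of a bounded column operator into `ℓ²`. -/
theorem exists_column (A : ι → H →L[ℂ] D) {C : ℝ} (hC : 0 ≤ C)
    (hA : ∀ (h : H) (F : Finset ι), ∑ i ∈ F, ‖A i h‖ ^ 2 ≤ C ^ 2 * ‖h‖ ^ 2) :
    ∃ V : H →L[ℂ] lp (fun _ : ι => D) 2, (∀ h i, V h i = A i h) ∧ ∀ h, ‖V h‖ ≤ C * ‖h‖ := by
  have sm : ∀ h, Summable fun i => ‖A i h‖ ^ 2 := fun h =>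
    summable_of_sum_le (fun _ => by positivity) (hA h)
  let L : H →ₗ[ℂ] lp (fun _ : ι => D) 2 :=
    { toFun := fun h => ⟨fun i => A i h, memℓp_two (sm h)⟩
      map_add' := fun x y => Subtype.ext (funext fun i => map_add (A i) x y)
      map_smul' := fun r x => Subtype.ext (funext fun i => map_smul (A i) r x) }
  have hL : ∀ h, ‖L h‖ ≤ C * ‖h‖ := fun h => by
    refine (sq_le_sq₀ (norm_nonneg _) (by positivity)).mp ?_
    rw [mul_pow]
    exact hasSum_le_of_sum_le (hasSum_sq (L h)) (hA h)
  exact ⟨L.mkContinuous C hL, fun h i => rfl, hL⟩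

omit [InnerProductSpace ℂ D] in
theorem sum_sq_le (x : lp (fun _ : ι => D) 2) (F : Finset ι) :
    ∑ i ∈ F, ‖x i‖ ^ 2 ≤ ‖x‖ ^ 2 :=
  sum_le_hasSum F (fun _ _ => by positivity) (hasSum_sq x)

/-- The entrywise action of an operator on `ℓ²`. -/
theorem exists_amplification (ι : Type*) (A : H →L[ℂ] H) :
    ∃ B : lp (fun _ : ι => H) 2 →L[ℂ] lp (fun _ : ι => H) 2,
      (∀ x i, B x i = A (x i)) ∧ ∀ x, ‖B x‖ ≤ ‖A‖ * ‖x‖ := by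
  refine exists_column (fun i => A ∘L lp.evalCLM ℂ (fun _ : ι => H) 2 i) (norm_nonneg A)
    fun x F => ?_
  refine le_trans (Finset.sum_le_sum fun i _ => ?_)
    ((Finset.mul_sum F (fun i => ‖x i‖ ^ 2) (‖A‖ ^ 2)).symm.le.trans
      (mul_le_mul_of_nonneg_left (sum_sq_le x F) (by positivity)))
  rw [← mul_pow]
  gcongr
  exact A.le_opNorm (x i)

variable [CompleteSpace H]

theorem hasSum_wot_iff {t : ι → H →WOT[ℂ] H} {A : H →WOT[ℂ] H} :
    HasSum t A ↔ ∀ h g : H, HasSum (fun i => ⟪g, t i h⟫_ℂ) ⟪g, A h⟫_ℂ := by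
  simp only [HasSum, ContinuousLinearMapWOT.tendsto_iff_forall_inner_apply_tendsto]
  refine forall₂_congr fun h g => ?_
  have : ∀ s : Finset ι, (∑ i ∈ s, t i) h = ∑ i ∈ s, t i h := fun s => by
    classical
    induction s using Finset.induction_on with
    | empty => simp
    | insert a s ha ih => rw [Finset.sum_insert ha, Finset.sum_insert ha, ← ih]; rfl
  simp only [this, inner_sum]

end columns

/-! ### The maps `Φ_{f,X}` -/

section phi

variable {N : ℕ} {H G : Type*} [NormedAddCommGroup H] [InnerProductSpace ℂ H] [CompleteSpace H]
  [NormedAddCommGroup G] [InnerProductSpace ℂ G] [CompleteSpace G]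
  (f : PositiveRegular N) (X : Fin N → (H →L[ℂ] H))

theorem inner_phiTerm (Y : H →L[ℂ] H) (α : FreeMonoid (Fin N)) (h g : H) :
    ⟪g, phiTerm f X Y α h⟫_ℂ =
      f.coeff α * ⟪star (FreeMonoid.lift X α) g, Y (star (FreeMonoid.lift X α) h)⟫_ℂ := by
  rw [ContinuousLinearMap.star_eq_adjoint, ContinuousLinearMap.adjoint_inner_left,
    ← inner_smul_right]
  rfl

variable {f X}

/-- If `∑ a_α ‖X_α^* h‖² ≤ C² ‖h‖²` for all `h`, then `Φ_{f,X}(Y) = V^* (I ⊗ Y) V` for the column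
`V = (√a_α X_α^*)_α`.  In particular the defining series converges for every `Y`. -/
theorem hasSum_phiTerm_of_bound {C : ℝ} (hC : 0 ≤ C)
    (hX : ∀ (h : H) (F : Finset (FreeMonoid (Fin N))),
      ∑ α ∈ F, f.coeff α * ‖star (FreeMonoid.lift X α) h‖ ^ 2 ≤ C ^ 2 * ‖h‖ ^ 2)
    (Y : H →L[ℂ] H) : HasSum (phiTerm f X Y) (.ofCLM (phi f X Y)) ∧ ‖phi f X Y‖ ≤ C ^ 2 * ‖Y‖ := by
  have sq : ∀ α, ((√(f.coeff α) : ℝ) : ℂ) * (√(f.coeff α) : ℝ) = f.coeff α := fun α => by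
    rw [← Complex.ofReal_mul, Real.mul_self_sqrt (f.coeff_nonneg α)]
  obtain ⟨V, hV, hVn⟩ := exists_column
    (fun α => ((√(f.coeff α) : ℝ) : ℂ) • star (FreeMonoid.lift X α)) hC fun h F => by
      refine le_trans (Finset.sum_le_sum fun α _ => ?_) (hX h F)
      rw [smul_apply, norm_smul, mul_pow, Complex.norm_real, Real.norm_eq_abs,
        sq_abs, Real.sq_sqrt (f.coeff_nonneg α)]
  obtain ⟨B, hB, hBn⟩ := exists_amplification (FreeMonoid (Fin N)) Y
  have key : HasSum (phiTerm f X Y) (.ofCLM (V.adjoint ∘L B ∘L V)) := by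
    rw [hasSum_wot_iff]
    intro h g
    have := lp.hasSum_inner (𝕜 := ℂ) (V g) (B (V h))
    rw [← ContinuousLinearMap.adjoint_inner_right] at this
    convert! this using 2 with α
    rw [inner_phiTerm, hB, hV, hV, smul_apply, smul_apply,
      map_smul, inner_smul_left, inner_smul_right, Complex.conj_ofReal, ← mul_assoc, sq]
  have e : phi f X Y = V.adjoint ∘L B ∘L V := by rw [phi, key.tsum_eq]
  refine ⟨by rw [e]; exact key, ?_⟩
  have nV : ‖V‖ ≤ C := V.opNorm_le_bound hC hVn
  have nB : ‖B‖ ≤ ‖Y‖ := B.opNorm_le_bound (norm_nonneg _) hBn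
  rw [e]
  calc ‖V.adjoint ∘L B ∘L V‖ ≤ ‖V.adjoint‖ * (‖B‖ * ‖V‖) :=
        (ContinuousLinearMap.opNorm_comp_le _ _).trans
          (mul_le_mul_of_nonneg_left (ContinuousLinearMap.opNorm_comp_le _ _) (norm_nonneg _))
    _ ≤ C * (‖Y‖ * C) := by
        rw [LinearIsometryEquiv.norm_map]
        gcongr
    _ = C ^ 2 * ‖Y‖ := by ring

theorem hasSum_inner_of_summable_one (hX : Summable (phiTerm f X 1)) (h : H) :
    HasSum (fun α => f.coeff α * ‖star (FreeMonoid.lift X α) h‖ ^ 2)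
      (RCLike.re ⟪h, phi f X 1 h⟫_ℂ) := by
  have := hasSum_wot_iff.mp hX.hasSum h h
  have := Complex.hasSum_re this
  convert! this using 2 with α
  rw [inner_phiTerm, Complex.re_ofReal_mul]
  exact congrArg _ (inner_self_eq_norm_sq (𝕜 := ℂ) _).symm

theorem exists_bound_of_summable_one (hX : Summable (phiTerm f X 1)) :
    ∀ (h : H) (F : Finset (FreeMonoid (Fin N))),
      ∑ α ∈ F, f.coeff α * ‖star (FreeMonoid.lift X α) h‖ ^ 2 ≤
        (√‖phi f X 1‖) ^ 2 * ‖h‖ ^ 2 := by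
  intro h F
  rw [Real.sq_sqrt (norm_nonneg _)]
  refine (sum_le_hasSum F (fun α _ => mul_nonneg (f.coeff_nonneg α) (by positivity))
    (hasSum_inner_of_summable_one hX h)).trans ?_
  refine (Complex.re_le_norm _).trans ((norm_inner_le_norm _ _).trans ?_)
  calc ‖h‖ * ‖phi f X 1 h‖ ≤ ‖h‖ * (‖phi f X 1‖ * ‖h‖) := by
        gcongr
        exact ContinuousLinearMap.le_opNorm _ _
    _ = _ := by ring

/-- Convergence at `I` gives convergence at every `Y`. -/
theorem hasSum_phiTerm (hX : Summable (phiTerm f X 1)) (Y : H →L[ℂ] H) :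
    HasSum (phiTerm f X Y) (.ofCLM (phi f X Y)) :=
  (hasSum_phiTerm_of_bound (Real.sqrt_nonneg _) (exists_bound_of_summable_one hX) Y).1

theorem norm_phi_le (hX : Summable (phiTerm f X 1)) (Y : H →L[ℂ] H) :
    ‖phi f X Y‖ ≤ ‖phi f X 1‖ * ‖Y‖ := by
  simpa using
    (hasSum_phiTerm_of_bound (Real.sqrt_nonneg _) (exists_bound_of_summable_one hX) Y).2

theorem hasSum_inner_phi (hX : Summable (phiTerm f X 1)) (Y : H →L[ℂ] H) (h g : H) :
    HasSum (fun α => f.coeff α *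
      ⟪star (FreeMonoid.lift X α) g, Y (star (FreeMonoid.lift X α) h)⟫_ℂ)
      ⟪g, phi f X Y h⟫_ℂ := by
  have := hasSum_wot_iff.mp (hasSum_phiTerm hX Y) h g
  simpa only [inner_phiTerm] using! this

theorem phi_add (hX : Summable (phiTerm f X 1)) (Y Z : H →L[ℂ] H) :
    phi f X (Y + Z) = phi f X Y + phi f X Z := by
  refine ContinuousLinearMap.ext fun h => ext_inner_left ℂ fun g => ?_
  refine (hasSum_inner_phi hX (Y + Z) h g).unique ?_
  rw [add_apply, inner_add_right]
  convert (hasSum_inner_phi hX Y h g).add (hasSum_inner_phi hX Z h g) using 2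
  rw [add_apply, inner_add_right, mul_add]

theorem phi_smul (hX : Summable (phiTerm f X 1)) (c : ℂ) (Y : H →L[ℂ] H) :
    phi f X (c • Y) = c • phi f X Y := by
  refine ContinuousLinearMap.ext fun h => ext_inner_left ℂ fun g => ?_
  refine (hasSum_inner_phi hX (c • Y) h g).unique ?_
  rw [smul_apply, inner_smul_right]
  convert! (hasSum_inner_phi hX Y h g).mul_left c using 2
  rw [smul_apply, inner_smul_right, mul_left_comm]

/-- `Φ_{f,X}` as a bounded operator on `B(H)`. -/
def phiCLM (hX : Summable (phiTerm f X 1)) : (H →L[ℂ] H) →L[ℂ] (H →L[ℂ] H) :=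
  LinearMap.mkContinuous
    { toFun := phi f X
      map_add' := phi_add hX
      map_smul' := phi_smul hX } ‖phi f X 1‖ (norm_phi_le hX)

theorem phiCLM_apply (hX : Summable (phiTerm f X 1)) (Y : H →L[ℂ] H) :
    phiCLM hX Y = phi f X Y := rfl

omit [CompleteSpace H] in
theorem nonneg_iff_inner {A : H →L[ℂ] H} : 0 ≤ A ↔ ∀ h, 0 ≤ ⟪h, A h⟫_ℂ := by
  rw [ContinuousLinearMap.nonneg_iff_isPositive]
  refine ⟨fun hA h => hA.inner_nonneg_right h, fun hA => ?_⟩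
  rw [ContinuousLinearMap.isPositive_iff_complex]
  intro h
  obtain ⟨h1, h2⟩ := Complex.nonneg_iff.mp (hA h)
  have e : ⟪A h, h⟫_ℂ = star ⟪h, A h⟫_ℂ := (inner_conj_symm _ _).symm
  rw [e]
  exact ⟨Complex.ext rfl (show (0 : ℝ) = -(⟪h, A h⟫_ℂ).im by rw [← h2, neg_zero]), h1⟩

theorem phi_nonneg {Y : H →L[ℂ] H} (hX : Summable (phiTerm f X 1)) (hY : 0 ≤ Y) :
    0 ≤ phi f X Y := by
  rw [nonneg_iff_inner] at *
  intro h
  exact (hasSum_inner_phi hX Y h h).nonneg fun α =>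
    mul_nonneg (by exact_mod_cast f.coeff_nonneg α) (hY _)

omit [CompleteSpace H] [CompleteSpace G] in
theorem lift_comp_of_intertwines {X' : Fin N → (G →L[ℂ] G)} {J : H →L[ℂ] G}
    (hJ : ∀ j, X' j ∘L J = J ∘L X j) (α : FreeMonoid (Fin N)) :
    FreeMonoid.lift X' α ∘L J = J ∘L FreeMonoid.lift X α := by
  induction α using FreeMonoid.recOn with
  | one => simp; rfl
  | of_mul j α ih =>
    rw [map_mul, map_mul, FreeMonoid.lift_eval_of, FreeMonoid.lift_eval_of]
    calc (X' j * FreeMonoid.lift X' α) ∘L J = X' j ∘L (FreeMonoid.lift X' α ∘L J) := rfl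
      _ = (X' j ∘L J) ∘L FreeMonoid.lift X α := by rw [ih]; rfl
      _ = _ := by rw [hJ]; rfl

theorem adjoint_lift_of_intertwines {X' : Fin N → (G →L[ℂ] G)} {J : H →L[ℂ] G}
    (hJ : ∀ j, X' j ∘L J = J ∘L X j) (α : FreeMonoid (Fin N)) (g : G) :
    J.adjoint (star (FreeMonoid.lift X' α) g) = star (FreeMonoid.lift X α) (J.adjoint g) := by
  have := congrArg ContinuousLinearMap.adjoint (lift_comp_of_intertwines hJ α)
  rw [ContinuousLinearMap.adjoint_comp, ContinuousLinearMap.adjoint_comp] at this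
  exact DFunLike.congr_fun this g

/-- An operator intertwining two tuples intertwines the associated maps. -/
theorem hasSum_phiTerm_of_intertwines (hX : Summable (phiTerm f X 1)) {X' : Fin N → (G →L[ℂ] G)}
    {J : H →L[ℂ] G} (hJ : ∀ j, X' j ∘L J = J ∘L X j) (Y : H →L[ℂ] H) :
    HasSum (phiTerm f X' (J ∘L Y ∘L J.adjoint)) (.ofCLM (J ∘L phi f X Y ∘L J.adjoint)) := by
  rw [hasSum_wot_iff]
  intro h g
  have := hasSum_inner_phi hX Y (J.adjoint h) (J.adjoint g)
  rw [ContinuousLinearMap.adjoint_inner_left] at this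
  convert! this using 2 with α
  rw [inner_phiTerm, ← adjoint_lift_of_intertwines hJ, ← adjoint_lift_of_intertwines hJ,
    ContinuousLinearMap.adjoint_inner_left]
  rfl

theorem phi_of_intertwines (hX : Summable (phiTerm f X 1)) {X' : Fin N → (G →L[ℂ] G)}
    {J : H →L[ℂ] G} (hJ : ∀ j, X' j ∘L J = J ∘L X j) (Y : H →L[ℂ] H) :
    phi f X' (J ∘L Y ∘L J.adjoint) = J ∘L phi f X Y ∘L J.adjoint := by
  rw [phi, (hasSum_phiTerm_of_intertwines hX hJ Y).tsum_eq]

end phi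

section defect

variable {k : ℕ} {n : Fin k → ℕ} {H G : Type*}
  [NormedAddCommGroup H] [InnerProductSpace ℂ H] [CompleteSpace H]
  [NormedAddCommGroup G] [InnerProductSpace ℂ G] [CompleteSpace G]
  {f : ∀ i, PositiveRegular (n i)} {X : OpTuple n H}

theorem compAll_eq_of_semiconj {A B : Type*} (c : A → B) (g : Fin k → A → A) (g' : Fin k → B → B)
    (h : ∀ i a, g' i (c a) = c (g i a)) (a : A) : compAll g' (c a) = c (compAll g a) := by
  unfold compAll
  rw [List.ofFn_eq_map, List.ofFn_eq_map]
  induction List.finRange k with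
  | nil => rfl
  | cons i l ih => simp only [List.map_cons, List.foldr_cons, Function.comp_apply, ih, h]

theorem defect_of_intertwines (hX : ∀ i, Summable (phiTerm (f i) (X i) 1)) {X' : OpTuple n G}
    {J : H →L[ℂ] G} (hJ : ∀ i j, X' i j ∘L J = J ∘L X i j) (p : Fin k → ℕ) (Y : H →L[ℂ] H) :
    defect f p X' (J ∘L Y ∘L J.adjoint) = J ∘L defect f p X Y ∘L J.adjoint := by
  refine compAll_eq_of_semiconj (fun Y => J ∘L Y ∘L J.adjoint) _ _ (fun i Y => ?_) Y
  refine ((Function.Semiconj.iterate_right (f := fun Y => J ∘L Y ∘L J.adjoint)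
    (fun Z => ?_) (p i)).eq Y).symm
  simp only
  rw [phi_of_intertwines (hX i) (hJ i)]
  ext; simp

end defect

/-! ### The coefficients `b_α` as convolution powers -/

/-- The coefficient of `t^p` in `(1 - t)^{-r}`. -/
def negBinom : ℕ → ℕ → ℝ
  | 0, p => if p = 0 then 1 else 0
  | r + 1, p => (p + r).choose r

theorem negBinom_zero_right (r : ℕ) : negBinom r 0 = 1 := by
  cases r <;> simp [negBinom]

theorem negBinom_nonneg (r p : ℕ) : 0 ≤ negBinom r p := by
  cases r with
  | zero => simp only [negBinom]; split_ifs <;> norm_num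
  | succ r => exact Nat.cast_nonneg _

theorem negBinom_succ_succ (r p : ℕ) :
    negBinom (r + 1) (p + 1) = negBinom (r + 1) p + negBinom r (p + 1) := by
  cases r with
  | zero => simp [negBinom]
  | succ r =>
    simp only [negBinom]
    rw [show p + 1 + (r + 1) = (p + r + 1) + 1 by ring, Nat.choose_succ_succ,
      show p + (r + 1) = p + r + 1 by ring, show p + 1 + r = p + r + 1 by ring]
    push_cast
    ring

section words

variable {N : ℕ}

/-- The prefix of length `i` of a word. -/
def wordPrefix (α : FreeMonoid (Fin N)) (i : ℕ) : FreeMonoid (Fin N) :=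
  FreeMonoid.ofList (α.toList.take i)

/-- What remains of a word once its prefix of length `i` is deleted. -/
def wordSuffix (α : FreeMonoid (Fin N)) (i : ℕ) : FreeMonoid (Fin N) :=
  FreeMonoid.ofList (α.toList.drop i)

theorem wordPrefix_mul_wordSuffix (α : FreeMonoid (Fin N)) (i : ℕ) :
    wordPrefix α i * wordSuffix α i = α :=
  congrArg FreeMonoid.ofList (List.take_append_drop i α.toList)

theorem wordPrefix_mul (α γ : FreeMonoid (Fin N)) : wordPrefix (α * γ) α.toList.length = α :=
  congrArg FreeMonoid.ofList (List.take_left (l₁ := α.toList) (l₂ := γ.toList))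

theorem wordSuffix_mul (α γ : FreeMonoid (Fin N)) : wordSuffix (α * γ) α.toList.length = γ :=
  congrArg FreeMonoid.ofList (List.drop_left (l₁ := α.toList) (l₂ := γ.toList))

/-- The convolution `∑_{γδ = α} a_γ u_δ` of functions on the free monoid. -/
def wordConv (a u : FreeMonoid (Fin N) → ℝ) (α : FreeMonoid (Fin N)) : ℝ :=
  ∑ i ∈ Finset.range (α.toList.length + 1), a (wordPrefix α i) * u (wordSuffix α i)

open Classical in
/-- The coefficients of the `p`-th power of the power series `f`. -/
def convPow (f : PositiveRegular N) : ℕ → FreeMonoid (Fin N) → ℝ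
  | 0 => fun α => if α = 1 then 1 else 0
  | p + 1 => wordConv f.coeff (convPow f p)

theorem convPow_nonneg (f : PositiveRegular N) (p : ℕ) (α : FreeMonoid (Fin N)) :
    0 ≤ convPow f p α := by
  induction p generalizing α with
  | zero => simp only [convPow]; split_ifs <;> norm_num
  | succ p ih =>
    simp only [convPow, wordConv]
    exact Finset.sum_nonneg fun i _ => mul_nonneg (f.coeff_nonneg _) (ih _)

theorem convPow_succ_one (f : PositiveRegular N) (p : ℕ) : convPow f (p + 1) 1 = 0 := by
  have : wordPrefix (1 : FreeMonoid (Fin N)) 0 = 1 := rfl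
  simp [convPow, wordConv, this, f.coeff_one]

/-- A sum over the compositions of the length of a nonempty word, organized by the first block. -/
theorem sum_composition (f : PositiveRegular N) (w : ℕ → ℝ) (l : List (Fin N)) (hl : l ≠ []) :
    ∑ c : Composition l.length,
      ((l.splitWrtComposition c).map fun γ => f.coeff (FreeMonoid.ofList γ)).prod * w c.length =
    ∑ i : Fin l.length, f.coeff (FreeMonoid.ofList (l.take (i + 1))) *
      ∑ c : Composition (l.drop (i + 1)).length,
        (((l.drop (i + 1)).splitWrtComposition c).map
          fun γ => f.coeff (FreeMonoid.ofList γ)).prod * w (c.length + 1) := by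
  let e : (Σ i : Fin l.length, Composition (l.drop (i + 1)).length) → Composition l.length :=
    fun x => ⟨(x.1 + 1) :: x.2.blocks, by
      intro i hi
      rcases List.mem_cons.mp hi with rfl | h
      · exact Nat.succ_pos _
      · exact x.2.blocks_pos h, by
      rw [List.sum_cons, x.2.blocks_sum, List.length_drop]
      omega⟩
  have he : Function.Bijective e := by
    constructor
    · rintro ⟨i, c⟩ ⟨j, d⟩ h
      obtain ⟨h1, h2⟩ := List.cons.inj (congrArg Composition.blocks h)
      obtain rfl : i = j := Fin.ext (Nat.succ_injective h1)
      exact congrArg _ (Composition.ext h2)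
    · intro c
      match hc : c.blocks with
      | [] =>
        have := c.blocks_sum
        rw [hc, List.sum_nil] at this
        exact absurd (List.length_eq_zero_iff.mp this.symm) hl
      | b :: bs =>
        have hs := c.blocks_sum
        rw [hc, List.sum_cons] at hs
        have hb : 0 < b := c.blocks_pos (by rw [hc]; exact List.mem_cons_self)
        refine ⟨⟨⟨b - 1, by omega⟩, ⟨bs, fun hi => c.blocks_pos (by
          rw [hc]; exact List.mem_cons_of_mem _ hi), by
            rw [List.length_drop]; simp only; omega⟩⟩, Composition.ext ?_⟩
        refine Eq.trans ?_ hc.symm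
        simp only [e]
        rw [Nat.sub_add_cancel hb]
  rw [← Fintype.sum_bijective e he _ _ fun _ => rfl, Fintype.sum_sigma]
  refine Finset.sum_congr rfl fun i _ => ?_
  rw [Finset.mul_sum]
  refine Finset.sum_congr rfl fun c _ => ?_
  have h1 : l.splitWrtComposition (e ⟨i, c⟩) =
      l.take (i + 1) :: (l.drop (i + 1)).splitWrtComposition c := by
    simp [List.splitWrtComposition, e, List.splitWrtCompositionAux_cons]
  have h2 : (e ⟨i, c⟩).length = c.length + 1 := by simp [e, Composition.length]
  rw [h1, h2, List.map_cons, List.prod_cons, mul_assoc]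

theorem wordConv_of_ne_one {a : FreeMonoid (Fin N) → ℝ} (ha : a 1 = 0)
    (u : FreeMonoid (Fin N) → ℝ) (α : FreeMonoid (Fin N)) :
    wordConv a u α =
      ∑ i : Fin α.toList.length, a (wordPrefix α (i + 1)) * u (wordSuffix α (i + 1)) := by
  have h0 : wordPrefix α 0 = 1 := rfl
  rw [wordConv, Finset.sum_range_succ', h0, ha, zero_mul, add_zero, Finset.sum_range]

theorem sum_composition_eq (f : PositiveRegular N) (w : ℕ → ℝ) (l : List (Fin N)) (q : ℕ)
    (hq : l.length < q) :
    ∑ c : Composition l.length,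
      ((l.splitWrtComposition c).map fun γ => f.coeff (FreeMonoid.ofList γ)).prod * w c.length =
    ∑ p ∈ Finset.range q, w p * convPow f p (FreeMonoid.ofList l) := by
  induction q generalizing l w with
  | zero => omega
  | succ q ih =>
    rw [Finset.sum_range_succ']
    by_cases hl : l = []
    · subst hl
      have h0 : FreeMonoid.ofList ([] : List (Fin N)) = 1 := rfl
      have hs : Subsingleton (Composition ([] : List (Fin N)).length) :=
        Fintype.card_le_one_iff_subsingleton.mp (composition_card 0).le
      rw [Fintype.sum_subsingleton _ (Composition.ones _)]
      simp only [h0, convPow_succ_one]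
      simp [List.splitWrtComposition, List.splitWrtCompositionAux, Composition.length, convPow]
    · have h0 : FreeMonoid.ofList l ≠ 1 := hl
      rw [sum_composition f w l hl]
      simp only [convPow, if_neg h0, mul_zero, add_zero]
      simp only [wordConv_of_ne_one f.coeff_one, Finset.mul_sum]
      rw [Finset.sum_comm]
      refine Finset.sum_congr rfl fun i _ => ?_
      have hlen : (l.drop (i + 1)).length < q := by
        have := i.2
        rw [List.length_drop]
        omega
      rw [← Finset.mul_sum, ih (fun p => w (p + 1)) _ hlen, Finset.mul_sum]
      exact Finset.sum_congr rfl fun p _ => mul_left_comm _ _ _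

/-- The coefficients of `(1 - f)^{-r}`.  The sum over `p` may stop at `|α|`, since `f` has no
constant term, so that `f^p` has no terms of degree less than `p`. -/
def invPow (f : PositiveRegular N) (r : ℕ) (α : FreeMonoid (Fin N)) : ℝ :=
  ∑ p ∈ Finset.range (α.toList.length + 1), negBinom r p * convPow f p α

theorem invPow_eq_sum (f : PositiveRegular N) (r : ℕ) (α : FreeMonoid (Fin N)) (q : ℕ)
    (hq : α.toList.length < q) :
    invPow f r α = ∑ p ∈ Finset.range q, negBinom r p * convPow f p α :=
  (sum_composition_eq f (negBinom r) α.toList _ (Nat.lt_succ_self _)).symm.trans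
    (sum_composition_eq f (negBinom r) α.toList q hq)

theorem b_eq_invPow (f : PositiveRegular N) {m : ℕ} (hm : 1 ≤ m) : f.b m = invPow f m := by
  funext α
  obtain ⟨r, rfl⟩ : ∃ r, m = r + 1 := ⟨m - 1, by omega⟩
  exact sum_composition_eq f (negBinom (r + 1)) α.toList _ (Nat.lt_succ_self _)

open Classical in
theorem invPow_zero (f : PositiveRegular N) (α : FreeMonoid (Fin N)) :
    invPow f 0 α = if α = 1 then 1 else 0 := by
  rw [invPow, Finset.sum_range_succ']
  simp [negBinom, convPow]

/-- The identity `(1 - f) (1 - f)^{-(r+1)} = (1 - f)^{-r}` for the coefficients. -/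
theorem invPow_succ_sub (f : PositiveRegular N) (r : ℕ) (α : FreeMonoid (Fin N)) :
    invPow f (r + 1) α - wordConv f.coeff (invPow f (r + 1)) α = invPow f r α := by
  set q := α.toList.length + 1 with hq
  have h1 : wordConv f.coeff (invPow f (r + 1)) α =
      ∑ p ∈ Finset.range q, negBinom (r + 1) p * convPow f (p + 1) α := by
    simp only [convPow, wordConv, Finset.mul_sum]
    rw [Finset.sum_comm]
    refine Finset.sum_congr rfl fun i _ => ?_
    have hlen : (wordSuffix α i).toList.length < q := by
      have : (wordSuffix α i).toList.length = α.toList.length - i := List.length_drop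
      omega
    rw [invPow_eq_sum f _ _ q hlen, Finset.mul_sum]
    exact Finset.sum_congr rfl fun p _ => mul_left_comm _ _ _
  rw [h1, invPow_eq_sum f (r + 1) α (q + 1) (by omega), invPow_eq_sum f r α (q + 1) (by omega),
    Finset.sum_range_succ' _ q, Finset.sum_range_succ' _ q, negBinom_zero_right,
    negBinom_zero_right,
    add_sub_right_comm, ← Finset.sum_sub_distrib]
  congr 1
  refine Finset.sum_congr rfl fun p _ => ?_
  rw [negBinom_succ_succ]
  ring

theorem b_pos (f : PositiveRegular N) (m : ℕ) (α : FreeMonoid (Fin N)) : 0 < f.b m α := by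
  induction α using FreeMonoid.recOn with
  | one => rw [f.b_one]; exact one_pos
  | of_mul j α ih => exact (mul_pos (f.coeff_of_pos j) ih).trans_le (f.coeff_mul_b_le m j α)

end words

/-! ### Commuting positive contractions on a space of operators -/

theorem nonneg_of_antitone_of_sum_bounded {c : ℕ → ℝ} (hc : ∀ s, c (s + 1) ≤ c s) {B : ℝ}
    (hB : ∀ q, -B ≤ ∑ s ∈ Finset.range q, c s) : 0 ≤ c 0 := by
  by_contra! h
  obtain ⟨q, hq⟩ := exists_nat_gt (B / (-c 0))
  have h1 : ∑ s ∈ Finset.range q, c s ≤ ∑ _s ∈ Finset.range q, c 0 :=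
    Finset.sum_le_sum fun s _ => antitone_nat_of_succ_le hc (Nat.zero_le s)
  rw [Finset.sum_const, Finset.card_range, nsmul_eq_mul] at h1
  rw [div_lt_iff₀ (by linarith)] at hq
  linarith [hB q]

theorem commute_list_prod_ofFn {M : Type*} [Monoid M] {k : ℕ} {x : M} {g : Fin k → M}
    (h : ∀ i, Commute x (g i)) : Commute x (List.ofFn g).prod :=
  Commute.list_prod_right _ _ fun y hy => by
    obtain ⟨i, rfl⟩ := List.mem_ofFn.mp hy
    exact h i

theorem list_prod_ofFn_mul {M : Type*} [Monoid M] {k : ℕ} {a b : Fin k → M}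
    (h : ∀ i j, i ≠ j → Commute (a i) (b j)) :
    (List.ofFn fun i => a i * b i).prod = (List.ofFn a).prod * (List.ofFn b).prod := by
  induction k with
  | zero => simp
  | succ k ih =>
    simp only [List.ofFn_succ, List.prod_cons]
    rw [ih fun i j hij => h _ _ (by simpa using hij)]
    have : Commute (List.ofFn fun i : Fin k => a i.succ).prod (b 0) :=
      (commute_list_prod_ofFn fun i => (h i.succ 0 (Fin.succ_ne_zero i)).symm).symm
    rw [mul_assoc, mul_assoc, ← mul_assoc (b 0), ← this.eq, mul_assoc]

/-- Multiplying one factor on the right by an element that commutes with all the others. -/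
theorem list_prod_ofFn_update_mul {M : Type*} [Monoid M] {k : ℕ} (g : Fin k → M) (i : Fin k) (y : M)
    (h : ∀ j, j ≠ i → Commute y (g j)) :
    (List.ofFn (Function.update g i (g i * y))).prod = (List.ofFn g).prod * y := by
  have hg : Function.update g i (g i * y) =
      fun l => g l * Function.update (1 : Fin k → M) i y l := by
    funext l
    by_cases hl : l = i
    · subst hl; simp
    · simp [hl]
  have hy : (List.ofFn (Function.update (1 : Fin k → M) i y)).prod = y := by
    rw [List.ofFn_eq_map, List.prod_map_eq_pow_single i _ fun j hj _ => by simp [hj]]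
    simp [List.count_eq_one_of_mem (List.nodup_finRange k) (List.mem_finRange i)]
  rw [hg, list_prod_ofFn_mul, hy]
  intro j l hjl
  by_cases hl : l = i
  · subst hl
    simpa using (h j hjl).symm
  · simp [hl]

section abstract

variable {E : Type*} [NormedAddCommGroup E] [NormedSpace ℂ E]

theorem mulCLM_apply (A B : E →L[ℂ] E) (x : E) : (A * B) x = A (B x) := rfl

theorem norm_pow_apply_le {P : E →L[ℂ] E} (hP : ‖P‖ ≤ 1) (q : ℕ) (D : E) : ‖(P ^ q) D‖ ≤ ‖D‖ := by
  induction q with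
  | zero => simp
  | succ q ih =>
    rw [pow_succ', mulCLM_apply]
    exact ((P.le_of_opNorm_le hP _).trans (one_mul _).le).trans ih

/-- If `φ (P^s (1 - P)² D) ≥ 0` for all `s`, then the numbers `φ (P^s (1 - P) D)` decrease with `s`
while their partial sums `φ ((1 - P^q) D)` stay bounded, so they are nonnegative. -/
theorem apply_one_sub_nonneg {P : E →L[ℂ] E} (hP : ‖P‖ ≤ 1) (φ : E →L[ℂ] ℂ) (D : E)
    (h : ∀ s : ℕ, 0 ≤ φ ((P ^ s * (1 - P) ^ 2 : E →L[ℂ] E) D)) : 0 ≤ φ ((1 - P) D) := by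
  set x : ℕ → ℂ := fun s => φ ((P ^ s * (1 - P)) D) with hx
  have hstep : ∀ s, 0 ≤ x s - x (s + 1) := fun s => by
    have e : x s - x (s + 1) = φ ((P ^ s * (1 - P) ^ 2 : E →L[ℂ] E) D) := by
      simp only [hx]
      rw [← map_sub, ← sub_apply]
      congr 2
      noncomm_ring
    rw [e]
    exact h s
  have hsum : ∀ q, ∑ s ∈ Finset.range q, x s = φ D - φ ((P ^ q) D) := fun q => by
    induction q with
    | zero => simp
    | succ q ih =>
      rw [Finset.sum_range_succ, ih]
      simp only [hx]
      rw [mul_sub, mul_one, ← pow_succ, sub_apply, map_sub]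
      ring
  have hbd : ∀ q, ‖∑ s ∈ Finset.range q, x s‖ ≤ 2 * (‖φ‖ * ‖D‖) := fun q => by
    have hq : ‖(P ^ q) D‖ ≤ ‖D‖ := norm_pow_apply_le hP q D
    rw [hsum]
    calc _ ≤ ‖φ D‖ + ‖φ ((P ^ q) D)‖ := norm_sub_le _ _
      _ ≤ ‖φ‖ * ‖D‖ + ‖φ‖ * ‖D‖ := by
        refine add_le_add (φ.le_opNorm _) ((φ.le_opNorm _).trans ?_)
        gcongr
      _ = _ := by ring
  have hx0 : x 0 = φ ((1 - P) D) := by simp [hx]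
  have hre : 0 ≤ (x 0).re := by
    refine nonneg_of_antitone_of_sum_bounded (c := fun s => (x s).re) (B := 2 * (‖φ‖ * ‖D‖))
      (fun s => ?_) fun q => ?_
    · have := (Complex.nonneg_iff.mp (hstep s)).1
      rw [Complex.sub_re] at this
      linarith
    · rw [← Complex.re_sum]
      exact (abs_le.mp ((Complex.abs_re_le_norm _).trans (hbd q))).1
  have him : ∀ s, (x (s + 1)).im = (x s).im := fun s => by
    have := (Complex.nonneg_iff.mp (hstep s)).2
    rw [Complex.sub_im] at this
    linarith
  have hi1 : 0 ≤ (x 0).im := by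
    refine nonneg_of_antitone_of_sum_bounded (c := fun s => (x s).im) (B := 2 * (‖φ‖ * ‖D‖))
      (fun s => (him s).le) fun q => ?_
    rw [← Complex.im_sum]
    exact (abs_le.mp ((Complex.abs_im_le_norm _).trans (hbd q))).1
  have hi2 : 0 ≤ -(x 0).im := by
    refine nonneg_of_antitone_of_sum_bounded (c := fun s => -(x s).im) (B := 2 * (‖φ‖ * ‖D‖))
      (fun s => (neg_le_neg (him s).ge)) fun q => ?_
    rw [Finset.sum_neg_distrib, ← Complex.im_sum]
    exact neg_le_neg (abs_le.mp ((Complex.abs_im_le_norm _).trans (hbd q))).2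
  rw [← hx0, Complex.nonneg_iff]
  exact ⟨hre, by linarith⟩

theorem apply_one_sub_eq_zero {P : E →L[ℂ] E} (hP : ‖P‖ ≤ 1) (φ : E →L[ℂ] ℂ) (D : E)
    (h : ∀ s : ℕ, φ ((P ^ s * (1 - P) ^ 2 : E →L[ℂ] E) D) = 0) : φ ((1 - P) D) = 0 :=
  le_antisymm (neg_nonneg.mp (apply_one_sub_nonneg hP (-φ) D fun s =>
    (neg_eq_zero.mpr (h s)).ge))
    (apply_one_sub_nonneg hP φ D fun s => (h s).ge)

theorem apply_one_sub_pow_eq_zero {P : E →L[ℂ] E} (hP : ‖P‖ ≤ 1) (φ : E →L[ℂ] ℂ) (D : E) {m : ℕ}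
    (hm : 1 ≤ m) (h : ∀ s : ℕ, φ ((P ^ s * (1 - P) ^ m : E →L[ℂ] E) D) = 0) (q : ℕ) :
    φ ((1 - P ^ q) D) = 0 := by
  induction m, hm using Nat.le_induction with
  | base =>
    induction q with
    | zero => simp
    | succ q ih =>
      have := h q
      rw [pow_one, mul_sub, mul_one, ← pow_succ, sub_apply, map_sub] at this
      rw [sub_apply, map_sub] at ih ⊢
      linear_combination ih + this
  | succ m hm ih =>
    obtain ⟨r, rfl⟩ : ∃ r, m = r + 1 := ⟨m - 1, by omega⟩
    refine ih fun s => ?_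
    have hc : ∀ a b : ℕ, Commute (P ^ a) ((1 - P) ^ b) := fun a b =>
      ((Commute.one_right P).sub_right (Commute.refl P)).pow_pow a b
    have := apply_one_sub_eq_zero hP φ ((P ^ s * (1 - P) ^ r) D) fun t => by
      rw [← mulCLM_apply, mul_assoc, ← mul_assoc _ (P ^ s), ← (hc s 2).eq, mul_assoc, ← pow_add,
        ← mul_assoc, ← pow_add]
      rw [add_comm 2 r]
      exact h (t + s)
    rw [← mulCLM_apply] at this
    convert this using 3
    have h1 := (hc s 1).eq
    rw [pow_one] at h1
    rw [pow_succ', ← mul_assoc, ← mul_assoc, h1]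

/-- If `φ` vanishes on all `∏ P_i^{s_i} (1 - P_i)^{m_i} D`, with commuting contractions `P_i`, then
it vanishes on all `∏ (1 - P_i^{q_i}) D`. -/
theorem apply_prod_eq_zero {k : ℕ} {P : Fin k → E →L[ℂ] E} (hc : ∀ i j, Commute (P i) (P j))
    (hP : ∀ i, ‖P i‖ ≤ 1) {m : Fin k → ℕ} (hm : ∀ i, 1 ≤ m i) (φ : E →L[ℂ] ℂ) (D : E)
    (h : ∀ s : Fin k → ℕ, φ (((List.ofFn fun i => P i ^ s i).prod *
      (List.ofFn fun i => (1 - P i) ^ m i).prod) D) = 0) (q : Fin k → ℕ) :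
    φ ((List.ofFn fun i => 1 - P i ^ q i).prod D) = 0 := by
  induction k generalizing D with
  | zero => simpa using h q
  | succ k ih =>
    have c1 : ∀ (i : Fin k) (a b : ℕ), Commute (P 0 ^ a) (P i.succ ^ b) := fun i a b =>
      (hc _ _).pow_pow a b
    have c2 : ∀ (i : Fin k) (a b : ℕ), Commute ((1 - P 0) ^ a) (P i.succ ^ b) := fun i a b =>
      ((Commute.one_left _).sub_left (hc _ _)).pow_pow a b
    have c3 : ∀ (i : Fin k) (a b : ℕ), Commute (P 0 ^ a) ((1 - P i.succ) ^ b) := fun i a b =>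
      ((Commute.one_right _).sub_right (hc _ _)).pow_pow a b
    have c4 : ∀ (i : Fin k) (a b : ℕ), Commute ((1 - P 0) ^ a) ((1 - P i.succ) ^ b) := fun i a b =>
      ((Commute.one_right _).sub_right
        ((Commute.one_left _).sub_left (hc _ _))).pow_pow a b
    have c5 : Commute (1 - P 0 ^ q 0) (List.ofFn fun i : Fin k => 1 - P i.succ ^ q i.succ).prod :=
      commute_list_prod_ofFn fun i => (Commute.one_right _).sub_right
        ((Commute.one_left _).sub_left (c1 i _ _))
    rw [List.ofFn_succ, List.prod_cons, c5.eq, mulCLM_apply]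
    refine apply_one_sub_pow_eq_zero (hP 0)
      (φ ∘L (List.ofFn fun i : Fin k => 1 - P i.succ ^ q i.succ).prod) D (hm 0) (fun s0 => ?_) (q 0)
    refine ih (fun i j => hc i.succ j.succ) (fun i => hP i.succ) (fun i => hm i.succ) _
      (fun s => ?_) fun i => q i.succ
    have := h (Fin.cons s0 s)
    rw [List.ofFn_succ, List.ofFn_succ, List.prod_cons, List.prod_cons] at this
    simp only [Fin.cons_zero, Fin.cons_succ] at this
    rw [← mulCLM_apply]
    convert this using 3
    have d1 : Commute (P 0 ^ s0) (List.ofFn fun i : Fin k => P i.succ ^ s i).prod :=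
      commute_list_prod_ofFn fun i => c1 i _ _
    have d2 : Commute (P 0 ^ s0) (List.ofFn fun i : Fin k => (1 - P i.succ) ^ m i.succ).prod :=
      commute_list_prod_ofFn fun i => c3 i _ _
    have d3 : Commute ((1 - P 0) ^ m 0)
        (List.ofFn fun i : Fin k => (1 - P i.succ) ^ m i.succ).prod :=
      commute_list_prod_ofFn fun i => c4 i _ _
    rw [d1.eq, mul_assoc, mul_assoc, (d2.mul_left d3).eq.symm, mul_assoc]

/-- The partial sums of the series of `(1 - P)^{-r}`. -/
def invPartial (P : E →L[ℂ] E) (r q : ℕ) : E →L[ℂ] E :=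
  ∑ p ∈ Finset.range q, (negBinom r p : ℂ) • P ^ p

theorem invPartial_succ_mul (P : E →L[ℂ] E) (r q : ℕ) :
    invPartial P (r + 1) (q + 1) * (1 - P) =
      invPartial P r (q + 1) - (negBinom (r + 1) q : ℂ) • P ^ (q + 1) := by
  induction q with
  | zero => simp [invPartial, negBinom_zero_right]
  | succ q ih =>
    rw [invPartial, Finset.sum_range_succ, ← invPartial, add_mul, ih, invPartial, invPartial,
      Finset.sum_range_succ _ (q + 1), negBinom_succ_succ, smul_mul_assoc, mul_sub, mul_one,
      ← pow_succ]
    push_cast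
    module

theorem commute_invPartial {A P : E →L[ℂ] E} (h : Commute A P) (r q : ℕ) :
    Commute A (invPartial P r q) :=
  Commute.sum_right _ _ _ fun p _ => (h.pow_right p).smul_right _

end abstract

section positive

variable {H : Type*} [NormedAddCommGroup H] [InnerProductSpace ℂ H] [CompleteSpace H]

/-- The functional `A ↦ ⟨A h, h⟩`. -/
def vectorState (h : H) : (H →L[ℂ] H) →L[ℂ] ℂ := innerSL ℂ h ∘L ContinuousLinearMap.apply ℂ H h

/-- Positive linear maps on `B(H)`. -/
def PositiveMap (P : (H →L[ℂ] H) →L[ℂ] (H →L[ℂ] H)) : Prop := ∀ Z, 0 ≤ Z → 0 ≤ P Z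

theorem PositiveMap.pow {P : (H →L[ℂ] H) →L[ℂ] (H →L[ℂ] H)} (hP : PositiveMap P) (s : ℕ) :
    PositiveMap (P ^ s) := by
  induction s with
  | zero => exact fun Z hZ => hZ
  | succ s ih =>
    intro Z hZ
    rw [pow_succ', mulCLM_apply]
    exact hP _ (ih Z hZ)

theorem PositiveMap.one_sub_pow_nonneg {P : (H →L[ℂ] H) →L[ℂ] (H →L[ℂ] H)} (hP : PositiveMap P)
    (hn : ‖P‖ ≤ 1) {Z : H →L[ℂ] H} (hZ : 0 ≤ Z) {m : ℕ} (hm : 0 ≤ ((1 - P) ^ m) Z) {p : ℕ}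
    (hp : p ≤ m) : 0 ≤ ((1 - P) ^ p) Z := by
  induction m, hp using Nat.le_induction with
  | base => exact hm
  | succ m hpm ih =>
    refine ih ?_
    rcases m with _ | r
    · exact hZ
    rw [nonneg_iff_inner]
    intro h
    rw [pow_succ', mulCLM_apply]
    refine apply_one_sub_nonneg hn (vectorState h) (((1 - P) ^ r) Z) fun s => ?_
    rw [← mulCLM_apply, mul_assoc, ← pow_add, add_comm 2 r, mulCLM_apply]
    exact nonneg_iff_inner.mp (hP.pow s _ hm) h

theorem PositiveMap.invPartial {P : (H →L[ℂ] H) →L[ℂ] (H →L[ℂ] H)} (hP : PositiveMap P)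
    (r q : ℕ) : PositiveMap (invPartial P r q) := by
  intro Z hZ
  rw [Polydomain.invPartial, sum_apply]
  refine Finset.sum_nonneg fun p _ => ?_
  rw [nonneg_iff_inner]
  intro h
  rw [smul_apply, smul_apply, inner_smul_right]
  exact mul_nonneg (by exact_mod_cast negBinom_nonneg r p)
    (nonneg_iff_inner.mp (hP.pow p Z hZ) h)

theorem PositiveMap.invPartial_le {P : (H →L[ℂ] H) →L[ℂ] (H →L[ℂ] H)} (hP : PositiveMap P)
    (hn : ‖P‖ ≤ 1) {Z : H →L[ℂ] H} (hZ : 0 ≤ Z) {m : ℕ} (hm : 0 ≤ ((1 - P) ^ m) Z) (q : ℕ) :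
    (Polydomain.invPartial P m (q + 1) * (1 - P) ^ m) Z ≤ Z := by
  have key : ∀ r ≤ m, (Polydomain.invPartial P r (q + 1) * (1 - P) ^ r) Z ≤ Z := by
    intro r hr
    induction r with
    | zero =>
      rw [Polydomain.invPartial, Finset.sum_range_succ']
      simp [negBinom]
    | succ r ih =>
      refine le_trans ?_ (ih (by omega))
      rw [pow_succ', ← mul_assoc, invPartial_succ_mul, sub_mul, sub_apply, sub_le_self_iff,
        mulCLM_apply, nonneg_iff_inner]
      intro h
      rw [smul_apply, smul_apply, inner_smul_right]
      exact mul_nonneg (by exact_mod_cast negBinom_nonneg _ _)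
        (nonneg_iff_inner.mp (hP.pow _ _ (hP.one_sub_pow_nonneg hn hZ hm (by omega))) h)
  exact key m le_rfl

/-- In several variables: if `∏ (1 - P_i)^{ε_i m_i} Z ≥ 0` for all `ε`, then the truncations of
`∏ (1 - P_i)^{-m_i}`, applied to `∏ (1 - P_i)^{m_i} Z`, stay below `Z`. -/
theorem prod_invPartial_le {k : ℕ} {P : Fin k → (H →L[ℂ] H) →L[ℂ] (H →L[ℂ] H)}
    (hc : ∀ i j, Commute (P i) (P j)) (hn : ∀ i, ‖P i‖ ≤ 1) (hP : ∀ i, PositiveMap (P i))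
    (m : Fin k → ℕ) (q : ℕ) (Z : H →L[ℂ] H)
    (hZ : ∀ ε : Fin k → Fin 2, 0 ≤ (List.ofFn fun i => (1 - P i) ^ ((ε i : ℕ) * m i)).prod Z) :
    (List.ofFn fun i => invPartial (P i) (m i) (q + 1) * (1 - P i) ^ m i).prod Z ≤ Z := by
  induction k generalizing Z with
  | zero => simp
  | succ k ih =>
    have hc' : ∀ i j (a b : ℕ), Commute ((1 - P i) ^ a) ((1 - P j) ^ b) := fun i j a b =>
      ((Commute.one_right _).sub_right
        ((Commute.one_left _).sub_left (hc _ _))).pow_pow a b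
    have hc1 : ∀ i j (b : ℕ), Commute (invPartial (P i) (m i) (q + 1)) ((1 - P j) ^ b) :=
      fun i j b =>
        (commute_invPartial (((Commute.one_left _).sub_left (hc j i)).pow_left b) _ _).symm
    have hc2 : ∀ i j, Commute (invPartial (P i) (m i) (q + 1)) (invPartial (P j) (m j) (q + 1)) :=
      fun i j => commute_invPartial (commute_invPartial (hc j i) _ _).symm _ _
    set A := invPartial (P 0) (m 0) (q + 1) * (1 - P 0) ^ m 0 with hA
    have hcA : ∀ j (b : ℕ), Commute A ((1 - P j) ^ b) := fun j b =>
      (hc1 0 j b).mul_left (hc' _ _ _ _)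
    have hε : ∀ (ε0 : Fin 2) (ε : Fin k → Fin 2), 0 ≤ ((1 - P 0) ^ ((ε0 : ℕ) * m 0))
        ((List.ofFn fun i : Fin k => (1 - P i.succ) ^ ((ε i : ℕ) * m i.succ)).prod Z) :=
      fun ε0 ε => by
        have := hZ (Fin.cons ε0 ε)
        rw [List.ofFn_succ, List.prod_cons, mulCLM_apply] at this
        simpa only [Fin.cons_zero, Fin.cons_succ] using this
    have h0 : ∀ ε : Fin k → Fin 2, 0 ≤
        (List.ofFn fun i : Fin k => (1 - P i.succ) ^ ((ε i : ℕ) * m i.succ)).prod Z := fun ε => by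
      simpa using hε 0 ε
    have h1 : ∀ ε : Fin k → Fin 2, 0 ≤ ((1 - P 0) ^ m 0)
        ((List.ofFn fun i : Fin k => (1 - P i.succ) ^ ((ε i : ℕ) * m i.succ)).prod Z) := fun ε => by
      simpa using hε 1 ε
    have cA : Commute A (List.ofFn fun i : Fin k =>
        invPartial (P i.succ) (m i.succ) (q + 1) * (1 - P i.succ) ^ m i.succ).prod :=
      commute_list_prod_ofFn fun i =>
        (((hc2 0 i.succ).mul_left (hc1 _ _ _).symm)).mul_right (hcA _ _)
    rw [List.ofFn_succ, List.prod_cons, ← hA, cA.eq, mulCLM_apply]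
    refine (ih (fun i j => hc i.succ j.succ) (fun i => hn i.succ) (fun i => hP i.succ)
      (fun i => m i.succ) (A Z) fun ε => ?_).trans ?_
    · have cE : Commute A (List.ofFn fun i : Fin k =>
          (1 - P i.succ) ^ ((ε i : ℕ) * m i.succ)).prod :=
        commute_list_prod_ofFn fun i => hcA _ _
      rw [← mulCLM_apply, ← cE.eq, mulCLM_apply, hA, mulCLM_apply]
      exact (hP 0).invPartial _ _ _ (h1 ε)
    · have h00 := h0 fun _ => 0
      have h10 := h1 fun _ => 0
      simp only [Fin.val_zero, zero_mul, pow_zero, List.ofFn_const, List.prod_replicate, one_pow]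
        at h00 h10
      exact (hP 0).invPartial_le (hn 0) h00 h10 q

end positive

/-! ### Square roots of positive operators -/

section sqrt

variable {H : Type*} [NormedAddCommGroup H] [InnerProductSpace ℂ H] [CompleteSpace H]

theorem posSqrt_isSelfAdjoint (A : H →L[ℂ] H) : (posSqrt A).adjoint = posSqrt A :=
  (IsSelfAdjoint.of_nonneg (CFC.sqrt_nonneg A)).star_eq

theorem posSqrt_mul_self {A : H →L[ℂ] H} (hA : 0 ≤ A) (x : H) : posSqrt A (posSqrt A x) = A x :=
  DFunLike.congr_fun (CFC.sqrt_mul_sqrt_self A hA) x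

theorem inner_posSqrt {A : H →L[ℂ] H} (hA : 0 ≤ A) (x y : H) :
    ⟪posSqrt A x, posSqrt A y⟫_ℂ = ⟪x, A y⟫_ℂ := by
  rw [← ContinuousLinearMap.adjoint_inner_right, posSqrt_isSelfAdjoint, posSqrt_mul_self hA]

theorem norm_posSqrt_sq {A : H →L[ℂ] H} (hA : 0 ≤ A) (x : H) :
    ‖posSqrt A x‖ ^ 2 = RCLike.re ⟪x, A x⟫_ℂ := by
  rw [← inner_posSqrt hA, inner_self_eq_norm_sq]

theorem posSqrt_mem_closedRange {A : H →L[ℂ] H} (hA : 0 ≤ A) (x : H) :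
    posSqrt A x ∈ closedRange A := by
  rw [closedRange, ← Submodule.orthogonal_orthogonal_eq_closure, Submodule.mem_orthogonal]
  intro z hz
  have h1 : ⟪A (A z), z⟫_ℂ = 0 := (Submodule.mem_orthogonal _ _).mp hz _ ⟨A z, rfl⟩
  have hAs : A.adjoint = A := (IsSelfAdjoint.of_nonneg hA).star_eq
  have h2 : A z = 0 := by
    rw [← ContinuousLinearMap.adjoint_inner_right, hAs, inner_self_eq_zero] at h1
    exact h1
  have h3 : posSqrt A z = 0 := by
    rw [← norm_eq_zero, ← sq_eq_zero_iff, norm_posSqrt_sq hA, h2, inner_zero_right, map_zero]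
  rw [← posSqrt_isSelfAdjoint, ContinuousLinearMap.adjoint_inner_right, h3, inner_zero_left]

end sqrt

/-! ### The defect maps of a tuple in the polydomain -/

section polydomain

variable {k : ℕ} {n : Fin k → ℕ} {m : Fin k → ℕ} {f : ∀ i, PositiveRegular (n i)}
  {H : Type*} [NormedAddCommGroup H] [InnerProductSpace ℂ H] [CompleteSpace H] {T : OpTuple n H}

theorem compAll_eq_prod {E : Type*} [NormedAddCommGroup E] [NormedSpace ℂ E]
    (A : Fin k → E →L[ℂ] E) (g : Fin k → E → E) (h : ∀ i x, g i x = A i x) (x : E) :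
    compAll g x = (List.ofFn A).prod x := by
  unfold compAll
  rw [List.ofFn_eq_map, List.ofFn_eq_map]
  induction List.finRange k with
  | nil => rfl
  | cons i l ih =>
    rw [List.map_cons, List.map_cons, List.foldr_cons, List.prod_cons, Function.comp_apply, ih, h]
    rfl

theorem one_sub_pow_apply {E : Type*} [NormedAddCommGroup E] [NormedSpace ℂ E]
    (P : E →L[ℂ] E) (p : ℕ) (x : E) : (fun y => y - P y)^[p] x = ((1 - P) ^ p) x := by
  induction p with
  | zero => rfl
  | succ p ih => rw [Function.iterate_succ_apply', ih, pow_succ', mulCLM_apply]; rfl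

theorem iterate_eq_pow_apply {E : Type*} [NormedAddCommGroup E] [NormedSpace ℂ E]
    (P : E →L[ℂ] E) (p : ℕ) (x : E) : P^[p] x = (P ^ p) x := by
  induction p with
  | zero => rfl
  | succ p ih => rw [Function.iterate_succ_apply', ih, pow_succ', mulCLM_apply]

theorem defect_eq_prod (hT : ∀ i, Summable (phiTerm (f i) (T i) 1)) (p : Fin k → ℕ)
    (Z : H →L[ℂ] H) :
    defect f p T Z = (List.ofFn fun i => (1 - phiCLM (hT i)) ^ p i).prod Z :=
  compAll_eq_prod _ _ (fun i x => one_sub_pow_apply (phiCLM (hT i)) (p i) x) Z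

theorem powerDefect_eq_prod (hT : ∀ i, Summable (phiTerm (f i) (T i) 1)) (q : Fin k → ℕ)
    (Z : H →L[ℂ] H) :
    powerDefect f q T Z = (List.ofFn fun i => 1 - phiCLM (hT i) ^ q i).prod Z :=
  compAll_eq_prod _ _ (fun i x =>
    congrArg (x - ·) (iterate_eq_pow_apply (phiCLM (hT i)) (q i) x)) Z

theorem commute_lift_right {M : Type*} [Monoid M] {N : ℕ} {x : M} {X : Fin N → M}
    (h : ∀ t, Commute x (X t)) (γ : FreeMonoid (Fin N)) : Commute x (FreeMonoid.lift X γ) := by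
  induction γ using FreeMonoid.recOn with
  | one => rw [map_one]; exact Commute.one_right _
  | of_mul t γ ih =>
    rw [map_mul, FreeMonoid.lift_eval_of]
    exact (h t).mul_right ih

theorem commute_lift {M : Type*} [Monoid M] {N N' : ℕ} {X : Fin N → M} {X' : Fin N' → M}
    (h : ∀ s t, Commute (X s) (X' t)) (α : FreeMonoid (Fin N)) (γ : FreeMonoid (Fin N')) :
    Commute (FreeMonoid.lift X α) (FreeMonoid.lift X' γ) :=
  commute_lift_right (fun t => (commute_lift_right (fun s => (h s t).symm) α).symm) γ

/-- The maps `Φ` of two commuting tuples commute: both compositions are given by the same absolutely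
convergent double series. -/
theorem phi_comm {N N' : ℕ} {g : PositiveRegular N} {g' : PositiveRegular N'}
    {X : Fin N → (H →L[ℂ] H)} {X' : Fin N' → (H →L[ℂ] H)} (hX : Summable (phiTerm g X 1))
    (hX' : Summable (phiTerm g' X' 1)) (hc : ∀ s t, Commute (X s) (X' t)) (Z : H →L[ℂ] H) :
    phi g X (phi g' X' Z) = phi g' X' (phi g X Z) := by
  have hs : ∀ α γ (h : H), star (FreeMonoid.lift X' γ) (star (FreeMonoid.lift X α) h) =
      star (FreeMonoid.lift X α) (star (FreeMonoid.lift X' γ) h) := fun α γ h =>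
    DFunLike.congr_fun (commute_lift hc α γ).star_star.eq.symm h
  refine ContinuousLinearMap.ext fun h => ext_inner_left ℂ fun h' => ?_
  set F : FreeMonoid (Fin N) × FreeMonoid (Fin N') → ℂ := fun x => g.coeff x.1 * (g'.coeff x.2 *
    ⟪star (FreeMonoid.lift X' x.2) (star (FreeMonoid.lift X x.1) h'),
      Z (star (FreeMonoid.lift X' x.2) (star (FreeMonoid.lift X x.1) h))⟫_ℂ) with hF
  have hsum : ∀ h : H, Summable fun x : FreeMonoid (Fin N) × FreeMonoid (Fin N') =>
      g.coeff x.1 * (g'.coeff x.2 *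
        ‖star (FreeMonoid.lift X' x.2) (star (FreeMonoid.lift X x.1) h)‖ ^ 2) := fun h => by
    have h1 : ∀ α, HasSum (fun γ => g.coeff α * (g'.coeff γ *
        ‖star (FreeMonoid.lift X' γ) (star (FreeMonoid.lift X α) h)‖ ^ 2))
        (g.coeff α * RCLike.re ⟪star (FreeMonoid.lift X α) h,
          phi g' X' 1 (star (FreeMonoid.lift X α) h)⟫_ℂ) := fun α =>
      (hasSum_inner_of_summable_one hX' (star (FreeMonoid.lift X α) h)).mul_left _
    refine (summable_prod_of_nonneg fun x => ?_).mpr ⟨fun α => (h1 α).summable, ?_⟩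
    · exact mul_nonneg (g.coeff_nonneg _) (mul_nonneg (g'.coeff_nonneg _) (by positivity))
    · simp only [(h1 _).tsum_eq]
      have := Complex.hasSum_re (hasSum_inner_phi hX (phi g' X' 1) h h)
      simp only [Complex.re_ofReal_mul] at this
      exact this.summable
  have hFs : Summable F := by
    refine Summable.of_norm_bounded (((hsum h').add (hsum h)).mul_left ‖Z‖) fun x => ?_
    set u := star (FreeMonoid.lift X' x.2) (star (FreeMonoid.lift X x.1) h')
    set v := star (FreeMonoid.lift X' x.2) (star (FreeMonoid.lift X x.1) h)
    have h1 : ‖⟪u, Z v⟫_ℂ‖ ≤ ‖Z‖ * (‖u‖ ^ 2 + ‖v‖ ^ 2) := by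
      calc ‖⟪u, Z v⟫_ℂ‖ ≤ ‖u‖ * (‖Z‖ * ‖v‖) := (norm_inner_le_norm _ _).trans (by
            gcongr; exact Z.le_opNorm v)
        _ = ‖Z‖ * (‖u‖ * ‖v‖) := by ring
        _ ≤ _ := by
            gcongr
            nlinarith [sq_nonneg (‖u‖ - ‖v‖), sq_nonneg ‖u‖, sq_nonneg ‖v‖]
    have ha := g.coeff_nonneg x.1
    have hb := g'.coeff_nonneg x.2
    rw [norm_mul, norm_mul, Complex.norm_real, Complex.norm_real, Real.norm_of_nonneg ha,
      Real.norm_of_nonneg hb]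
    calc _ ≤ g.coeff x.1 * (g'.coeff x.2 * (‖Z‖ * (‖u‖ ^ 2 + ‖v‖ ^ 2))) := by gcongr
      _ = _ := by ring
  have e1 : ⟪h', phi g X (phi g' X' Z) h⟫_ℂ = ∑' x, F x := by
    refine (hasSum_inner_phi hX _ h h').unique ?_
    exact hFs.hasSum.prod_fiberwise fun α =>
      (hasSum_inner_phi hX' Z (star (FreeMonoid.lift X α) h)
        (star (FreeMonoid.lift X α) h')).mul_left (g.coeff α : ℂ)
  have e2 : ⟪h', phi g' X' (phi g X Z) h⟫_ℂ = ∑' x, F x := by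
    refine (hasSum_inner_phi hX' _ h h').unique ?_
    refine ((Equiv.prodComm _ _).hasSum_iff.mpr hFs.hasSum).prod_fiberwise fun γ => ?_
    have := (hasSum_inner_phi hX Z (star (FreeMonoid.lift X' γ) h)
        (star (FreeMonoid.lift X' γ) h')).mul_left (g'.coeff γ : ℂ)
    convert! this using 2 with α
    simp only [hF, Function.comp_apply, Equiv.prodComm_apply, Prod.fst_swap, Prod.snd_swap, hs]
    ring
  rw [e1, e2]

theorem MemPolydomain.commute_phiCLM (hT : MemPolydomain f m T) (i j : Fin k) :
    Commute (phiCLM (hT.summable i)) (phiCLM (hT.summable j)) := by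
  by_cases hij : i = j
  · subst hij; exact Commute.refl _
  · exact ContinuousLinearMap.ext fun Z =>
      phi_comm (hT.summable i) (hT.summable j) (hT.commute i j hij) Z

theorem MemPolydomain.norm_phiCLM_le (hT : MemPolydomain f m T) (i : Fin k) :
    ‖phiCLM (hT.summable i)‖ ≤ 1 := by
  have h1 : ‖phi (f i) (T i) 1‖ ≤ 1 :=
    (CStarAlgebra.norm_le_one_iff_of_nonneg _
      (phi_nonneg (hT.summable i) zero_le_one)).mpr (hT.phi_le i)
  exact ContinuousLinearMap.opNorm_le_bound _ zero_le_one fun Z =>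
    (norm_phi_le (hT.summable i) Z).trans (by gcongr)

theorem positiveMap_phiCLM {N : ℕ} {g : PositiveRegular N} {X : Fin N → (H →L[ℂ] H)}
    (hX : Summable (phiTerm g X 1)) : PositiveMap (phiCLM hX) := fun _ hZ => phi_nonneg hX hZ

theorem MemPolydomain.defect_nonneg' (hT : MemPolydomain f m T) : 0 ≤ defect f m T 1 := by
  simpa using hT.defect_nonneg fun _ => 1

/-! ### The Berezin kernel -/

/-- The operator `T_{1,β_1}^* ⋯ T_{k,β_k}^*`. -/
def starWord (T : OpTuple n H) (β : Words n) : H →L[ℂ] H :=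
  (List.ofFn fun i => star (FreeMonoid.lift (T i) (β i))).prod

theorem starWord_update (hc : ∀ p q, p ≠ q → ∀ s t, Commute (T p s) (T q t)) (i : Fin k)
    (α : FreeMonoid (Fin (n i))) (β : Words n) :
    starWord T (Function.update β i (α * β i)) =
      starWord T β * star (FreeMonoid.lift (T i) α) := by
  have := list_prod_ofFn_update_mul (fun i => star (FreeMonoid.lift (T i) (β i))) i
    (star (FreeMonoid.lift (T i) α)) fun j hj =>
      (commute_lift (hc i j hj.symm) α (β j)).star_star
  rw [starWord, starWord, ← this]
  congr 2
  funext l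
  by_cases hl : l = i
  · subst hl; simp
  · simp [hl]

theorem starWord_one (T : OpTuple n H) : starWord T 1 = 1 := by
  simp [starWord]

/-- The weight `√b_{1,β_1} ⋯ √b_{k,β_k}`. -/
def sqrtWeight (f : ∀ i, PositiveRegular (n i)) (m : Fin k → ℕ) (β : Words n) : ℝ :=
  ∏ i, √((f i).b (m i) (β i))

theorem sqrtWeight_pos (f : ∀ i, PositiveRegular (n i)) (m : Fin k → ℕ) (β : Words n) :
    0 < sqrtWeight f m β :=
  Finset.prod_pos fun _ _ => Real.sqrt_pos.mpr (b_pos _ _ _)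

theorem sqrtWeight_sq (f : ∀ i, PositiveRegular (n i)) (m : Fin k → ℕ) (β : Words n) :
    sqrtWeight f m β ^ 2 = ∏ i, (f i).b (m i) (β i) := by
  rw [sqrtWeight, ← Finset.prod_pow]
  exact Finset.prod_congr rfl fun i _ => Real.sq_sqrt ((f i).b_nonneg _ _)

theorem exists_isBerezinKernel (hΔ : 0 ≤ defect f m T 1)
    (h : ∀ (h : H) (F : Finset (Words n)), ∑ β ∈ F,
      sqrtWeight f m β ^ 2 * ‖posSqrt (defect f m T 1) (starWord T β h)‖ ^ 2 ≤ ‖h‖ ^ 2) :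
    ∃ K, IsBerezinKernel f m T K := by
  obtain ⟨K, hK, -⟩ := exists_column (fun β : Words n => ((sqrtWeight f m β : ℝ) : ℂ) •
    ((posSqrt (defect f m T 1)).codRestrict (defectSpace f m T)
      (posSqrt_mem_closedRange hΔ) ∘L starWord T β)) zero_le_one fun x F => by
    rw [one_pow, one_mul]
    refine le_trans (Finset.sum_le_sum fun β _ => ?_) (h x F)
    rw [smul_apply, norm_smul, mul_pow, Complex.norm_real, Real.norm_eq_abs, sq_abs]
    rfl
  refine ⟨K, fun x β => ?_⟩
  rw [hK]
  rfl

theorem IsBerezinKernel.unique {K K' : H →L[ℂ] Fock n (defectSpace f m T)}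
    (h : IsBerezinKernel f m T K) (h' : IsBerezinKernel f m T K') : K = K' :=
  ContinuousLinearMap.ext fun x =>
    lp.ext (funext fun β => Subtype.ext ((h x β).trans (h' x β).symm))

theorem isBerezinKernel_berezinKernel (h : ∃ K, IsBerezinKernel f m T K) :
    IsBerezinKernel f m T (berezinKernel f m T) := by
  rw [berezinKernel, dif_pos h]
  exact h.choose_spec

end polydomain

/-! ### Existence and injectivity of the Berezin kernel -/

section kernel

variable {k : ℕ} {n : Fin k → ℕ} {m : Fin k → ℕ} {f : ∀ i, PositiveRegular (n i)}
  {H : Type*} [NormedAddCommGroup H] [InnerProductSpace ℂ H] [CompleteSpace H] {T : OpTuple n H}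

/-- The quadratic form `⟨Z h, h⟩` of a positive operator, with values in `[0, ∞]`. -/
def quadForm (Z : H →L[ℂ] H) (h : H) : ℝ≥0∞ := ENNReal.ofReal (RCLike.re ⟪h, Z h⟫_ℂ)

theorem tsum_coeff_mul_quadForm {N : ℕ} {g : PositiveRegular N} {X : Fin N → (H →L[ℂ] H)}
    (hX : Summable (phiTerm g X 1)) {Z : H →L[ℂ] H} (hZ : 0 ≤ Z) (h : H) :
    ∑' α, ENNReal.ofReal (g.coeff α) * quadForm Z (star (FreeMonoid.lift X α) h) =
      quadForm (phi g X Z) h := by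
  have := Complex.hasSum_re (hasSum_inner_phi hX Z h h)
  simp only [Complex.re_ofReal_mul] at this
  rw [quadForm, RCLike.re_eq_complex_re, ← this.tsum_eq,
    ENNReal.ofReal_tsum_of_nonneg _ this.summable]
  · exact tsum_congr fun α => (ENNReal.ofReal_mul (g.coeff_nonneg α)).symm
  · exact fun α => mul_nonneg (g.coeff_nonneg α)
      (Complex.nonneg_iff.mp (nonneg_iff_inner.mp hZ _)).1

/-- Deconcatenation of words is injective, so a series over the factorizations of all words is at
most the corresponding double series. -/
theorem tsum_sum_wordPrefix_le {N : ℕ} (F : FreeMonoid (Fin N) → FreeMonoid (Fin N) → ℝ≥0∞) :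
    ∑' α, ∑ i ∈ Finset.range (α.toList.length + 1), F (wordPrefix α i) (wordSuffix α i) ≤
      ∑' γ, ∑' δ, F γ δ := by
  let e : (Σ α : FreeMonoid (Fin N), Fin (α.toList.length + 1)) →
      FreeMonoid (Fin N) × FreeMonoid (Fin N) := fun x => (wordPrefix x.1 x.2, wordSuffix x.1 x.2)
  have he : Function.Injective e := by
    rintro ⟨α, i⟩ ⟨β, j⟩ h
    obtain ⟨h1, h2⟩ := Prod.mk.inj h
    have hαβ : α = β := by
      rw [← wordPrefix_mul_wordSuffix α i, ← wordPrefix_mul_wordSuffix β j]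
      exact congrArg₂ _ h1 h2
    subst hαβ
    have hl : ∀ i : Fin (α.toList.length + 1), (wordPrefix α i).toList.length = i := fun i =>
      List.length_take_of_le (Nat.lt_succ_iff.mp i.2)
    have : (i : ℕ) = j := by rw [← hl i, ← hl j]; exact congrArg _ h1
    rw [Fin.ext this]
  rw [← ENNReal.tsum_prod]
  refine le_trans (le_of_eq ?_) (ENNReal.tsum_comp_le_tsum_of_injective he fun p => F p.1 p.2)
  rw [ENNReal.tsum_sigma']
  refine tsum_congr fun α => ?_
  rw [tsum_fintype, Finset.sum_range]

theorem tsum_convPow_mul_quadForm_le {N : ℕ} {g : PositiveRegular N} {X : Fin N → (H →L[ℂ] H)}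
    (hX : Summable (phiTerm g X 1)) {Z : H →L[ℂ] H} (hZ : 0 ≤ Z) (p : ℕ) (h : H) :
    ∑' α, ENNReal.ofReal (convPow g p α) * quadForm Z (star (FreeMonoid.lift X α) h) ≤
      quadForm ((phiCLM hX ^ p) Z) h := by
  induction p generalizing h with
  | zero =>
    rw [tsum_eq_single 1 fun α hα => by simp [convPow, hα]]
    simp [convPow]
  | succ p ih =>
    have hpos := (positiveMap_phiCLM hX).pow p Z hZ
    rw [pow_succ', mulCLM_apply, phiCLM_apply, ← tsum_coeff_mul_quadForm hX hpos]
    refine le_trans (le_of_eq ?_) ((tsum_sum_wordPrefix_le fun γ δ => ENNReal.ofReal (g.coeff γ) *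
      (ENNReal.ofReal (convPow g p δ) *
        quadForm Z (star (FreeMonoid.lift X δ) (star (FreeMonoid.lift X γ) h)))).trans ?_)
    · refine tsum_congr fun α => ?_
      rw [convPow, wordConv, ENNReal.ofReal_sum_of_nonneg fun i _ =>
        mul_nonneg (g.coeff_nonneg _) (convPow_nonneg g p _), Finset.sum_mul]
      refine Finset.sum_congr rfl fun i _ => ?_
      rw [ENNReal.ofReal_mul (g.coeff_nonneg _), mul_assoc]
      congr 3
      conv_lhs => rw [← wordPrefix_mul_wordSuffix α i, map_mul, star_mul]
      rfl
    · refine ENNReal.tsum_le_tsum fun γ => ?_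
      rw [ENNReal.tsum_mul_left]
      gcongr
      exact ih _

theorem tsum_invPow_mul_quadForm_le {N : ℕ} {g : PositiveRegular N} {X : Fin N → (H →L[ℂ] H)}
    (hX : Summable (phiTerm g X 1)) {Z : H →L[ℂ] H} (hZ : 0 ≤ Z) (r q : ℕ) (h : H) :
    ∑' α, ENNReal.ofReal (∑ p ∈ Finset.range q, negBinom r p * convPow g p α) *
      quadForm Z (star (FreeMonoid.lift X α) h) ≤ quadForm (invPartial (phiCLM hX) r q Z) h := by
  have hpos : ∀ p, 0 ≤ RCLike.re ⟪h, (phiCLM hX ^ p) Z h⟫_ℂ := fun p =>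
    (Complex.nonneg_iff.mp (nonneg_iff_inner.mp ((positiveMap_phiCLM hX).pow p Z hZ) _)).1
  have e : quadForm (invPartial (phiCLM hX) r q Z) h =
      ∑ p ∈ Finset.range q, ENNReal.ofReal (negBinom r p) * quadForm ((phiCLM hX ^ p) Z) h := by
    rw [quadForm, invPartial, sum_apply, sum_apply, inner_sum, map_sum,
      ENNReal.ofReal_sum_of_nonneg]
    · refine Finset.sum_congr rfl fun p _ => ?_
      rw [smul_apply, smul_apply, inner_smul_right, RCLike.re_eq_complex_re, Complex.re_ofReal_mul,
        ENNReal.ofReal_mul (negBinom_nonneg r p)]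
      rfl
    · intro p _
      rw [smul_apply, smul_apply, inner_smul_right, RCLike.re_eq_complex_re, Complex.re_ofReal_mul]
      exact mul_nonneg (negBinom_nonneg r p) (hpos p)
  rw [e]
  have e2 : ∀ α, ENNReal.ofReal (∑ p ∈ Finset.range q, negBinom r p * convPow g p α) *
      quadForm Z (star (FreeMonoid.lift X α) h) = ∑ p ∈ Finset.range q,
        ENNReal.ofReal (negBinom r p) * (ENNReal.ofReal (convPow g p α) *
          quadForm Z (star (FreeMonoid.lift X α) h)) := fun α => by
    rw [ENNReal.ofReal_sum_of_nonneg fun p _ =>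
      mul_nonneg (negBinom_nonneg r p) (convPow_nonneg g p α), Finset.sum_mul]
    refine Finset.sum_congr rfl fun p _ => ?_
    rw [ENNReal.ofReal_mul (negBinom_nonneg r p), mul_assoc]
  simp only [e2]
  rw [Summable.tsum_finsetSum fun _ _ => ENNReal.summable]
  refine Finset.sum_le_sum fun p _ => ?_
  rw [ENNReal.tsum_mul_left]
  gcongr
  exact tsum_convPow_mul_quadForm_le hX hZ p h

/-- Bounds in each variable combine to a bound for the multiple series. -/
theorem tsum_prod_mul_quadForm_le {k : ℕ} {ι : Fin k → Type*} (c : ∀ i, ι i → ℝ≥0∞)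
    (R : ∀ i, ι i → (H →L[ℂ] H)) (S : Fin k → (H →L[ℂ] H) →L[ℂ] (H →L[ℂ] H))
    (hS : ∀ i, PositiveMap (S i)) (hc : ∀ i j, Commute (S i) (S j))
    (hR : ∀ i Z, 0 ≤ Z → ∀ h, ∑' α, c i α * quadForm Z (R i α h) ≤ quadForm (S i Z) h)
    {Z : H →L[ℂ] H} (hZ : 0 ≤ Z) (h : H) :
    ∑' β : ∀ i, ι i, (∏ i, c i (β i)) * quadForm Z ((List.ofFn fun i => R i (β i)).prod h) ≤
      quadForm ((List.ofFn S).prod Z) h := by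
  induction k generalizing Z with
  | zero => simp
  | succ k ih =>
    rw [← (Fin.consEquiv ι).tsum_eq, ENNReal.tsum_prod', ENNReal.tsum_comm]
    have cS : Commute (S 0) (List.ofFn fun i : Fin k => S i.succ).prod :=
      commute_list_prod_ofFn fun i => hc _ _
    rw [List.ofFn_succ, List.prod_cons, cS.eq, mulCLM_apply]
    refine le_trans (ENNReal.tsum_le_tsum fun β => ?_) (ih (fun i => c i.succ) (fun i => R i.succ)
      (fun i => S i.succ) (fun i => hS _) (fun i j => hc _ _) (fun i => hR _) (hS 0 Z hZ))
    simp only [Fin.consEquiv_apply, Fin.prod_univ_succ, Fin.cons_zero, Fin.cons_succ,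
      List.ofFn_succ, List.prod_cons, mul_assoc, mul_left_comm (c 0 _)]
    rw [ENNReal.tsum_mul_left]
    gcongr
    exact hR 0 Z hZ _

/-- For a tuple in the polydomain, `K^* K ≤ I`. -/
theorem MemPolydomain.sum_le (hT : MemPolydomain f m T) (hm : ∀ i, 1 ≤ m i) (h : H)
    (F : Finset (Words n)) : ∑ β ∈ F,
      sqrtWeight f m β ^ 2 * ‖posSqrt (defect f m T 1) (starWord T β h)‖ ^ 2 ≤ ‖h‖ ^ 2 := by
  have hΔ := hT.defect_nonneg'
  set Δ := defect f m T 1 with hΔd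
  set P := fun i => phiCLM (hT.summable i) with hPd
  -- a bound for the lengths of all the words that occur in `F`
  obtain ⟨q, hq⟩ : ∃ q, ∀ β ∈ F, ∀ i, (β i).toList.length < q + 1 :=
    ⟨F.sup fun β => Finset.univ.sup fun i => (β i).toList.length, fun β hβ i =>
      Nat.lt_succ_of_le ((Finset.le_sup (f := fun i => (β i).toList.length)
        (Finset.mem_univ i)).trans
          (Finset.le_sup (f := fun β : Words n => Finset.univ.sup fun i => (β i).toList.length)
            hβ))⟩
  have hcS : ∀ i j, Commute (invPartial (P i) (m i) (q + 1)) (invPartial (P j) (m j) (q + 1)) :=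
    fun i j => commute_invPartial (commute_invPartial (hT.commute_phiCLM j i) _ _).symm _ _
  have hcD : ∀ i j, Commute (invPartial (P i) (m i) (q + 1)) ((1 - P j) ^ m j) := fun i j =>
    (commute_invPartial (((Commute.one_left _).sub_left
      (hT.commute_phiCLM j i)).pow_left (m j)) _ _).symm
  have hle : (List.ofFn fun i => invPartial (P i) (m i) (q + 1)).prod Δ ≤ 1 := by
    have := prod_invPartial_le (fun i j => hT.commute_phiCLM i j) (fun i => hT.norm_phiCLM_le i)
      (fun i => positiveMap_phiCLM (hT.summable i)) m q 1 fun ε => by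
        rw [← defect_eq_prod hT.summable fun i => (ε i : ℕ) * m i]
        exact hT.defect_nonneg ε
    rwa [list_prod_ofFn_mul fun i j _ => hcD i j, mulCLM_apply,
      ← defect_eq_prod hT.summable] at this
  have hq1 : quadForm ((List.ofFn fun i => invPartial (P i) (m i) (q + 1)).prod Δ) h ≤
      ENNReal.ofReal (‖h‖ ^ 2) := by
    refine ENNReal.ofReal_le_ofReal ?_
    have := (Complex.nonneg_iff.mp (nonneg_iff_inner.mp (sub_nonneg.mpr hle) h)).1
    rw [sub_apply, inner_sub_right, Complex.sub_re] at this
    have h1 : (⟪h, (1 : H →L[ℂ] H) h⟫_ℂ).re = ‖h‖ ^ 2 := inner_self_eq_norm_sq (𝕜 := ℂ) h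
    rw [h1] at this
    exact sub_nonneg.mp this
  have hsum := (tsum_prod_mul_quadForm_le
    (fun i α => ENNReal.ofReal (∑ p ∈ Finset.range (q + 1), negBinom (m i) p * convPow (f i) p α))
    (fun i α => star (FreeMonoid.lift (T i) α)) (fun i => invPartial (P i) (m i) (q + 1))
    (fun i => (positiveMap_phiCLM (hT.summable i)).invPartial _ _) hcS
    (fun i Z hZ h => tsum_invPow_mul_quadForm_le (hT.summable i) hZ _ _ h) hΔ h).trans hq1
  rw [← ENNReal.ofReal_le_ofReal_iff (by positivity),
    ENNReal.ofReal_sum_of_nonneg fun _ _ => by positivity]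
  refine le_trans (Finset.sum_le_sum fun β hβ => le_of_eq ?_) ((ENNReal.sum_le_tsum F).trans hsum)
  rw [ENNReal.ofReal_mul (by positivity), norm_posSqrt_sq hΔ, sqrtWeight_sq,
    ENNReal.ofReal_prod_of_nonneg fun i _ => (f i).b_nonneg _ _]
  congr 1
  refine Finset.prod_congr rfl fun i _ => ?_
  rw [b_eq_invPow (f i) (hm i), invPow_eq_sum (f i) (m i) (β i) (q + 1) (hq β hβ i)]

theorem MemPolydomain.isBerezinKernel (hT : MemPolydomain f m T) (hm : ∀ i, 1 ≤ m i) :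
    IsBerezinKernel f m T (berezinKernel f m T) :=
  isBerezinKernel_berezinKernel (exists_isBerezinKernel hT.defect_nonneg' (hT.sum_le hm))

/-- The Berezin kernel of a completely non-coisometric tuple is injective: if `K h = 0`, then all
the numbers `⟨Φ^s Δ^m(I) h, h⟩` vanish, and hence so do those with `m` replaced by `(1, …, 1)`. -/
theorem CompletelyNonCoisometric.berezinKernel_injective (hT : CompletelyNonCoisometric f m T)
    (hm : ∀ i, 1 ≤ m i) : Function.Injective (berezinKernel f m T) := by
  obtain ⟨hT, hc⟩ := hT
  have hK := hT.isBerezinKernel hm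
  have hΔ := hT.defect_nonneg'
  rw [injective_iff_map_eq_zero]
  intro h hh
  by_contra hne
  refine hc ⟨h, hne, fun q _ => ?_⟩
  set S : Set H := {x | ∀ β, posSqrt (defect f m T 1) (starWord T β x) = 0} with hS
  have hhS : h ∈ S := fun β => by
    have := hK h β
    rw [hh] at this
    exact (smul_eq_zero.mp this.symm).resolve_left
      (by exact_mod_cast (sqrtWeight_pos f m β).ne')
  have hinv : ∀ x ∈ S, ∀ i α, star (FreeMonoid.lift (T i) α) x ∈ S := fun x hx i α β => by
    have := hx (Function.update β i (α * β i))
    rwa [starWord_update hT.commute] at this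
  have hstep : ∀ i (Z : H →L[ℂ] H), (∀ x ∈ S, ⟪x, Z x⟫_ℂ = 0) →
      ∀ x ∈ S, ⟪x, phiCLM (hT.summable i) Z x⟫_ℂ = 0 := fun i Z hZ x hx => by
    refine (hasSum_inner_phi (hT.summable i) Z x x).unique ?_
    convert hasSum_zero using 2 with α
    rw [hZ _ (hinv x hx i α), mul_zero]
  have h0 : ∀ x ∈ S, ⟪x, defect f m T 1 x⟫_ℂ = 0 := fun x hx => by
    have := hx 1
    rw [starWord_one] at this
    rw [← inner_posSqrt hΔ]
    exact (congrArg (⟪·, _⟫_ℂ) this).trans (inner_zero_left _)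
  have hpow : ∀ i (s : ℕ) (Z : H →L[ℂ] H), (∀ x ∈ S, ⟪x, Z x⟫_ℂ = 0) →
      ∀ x ∈ S, ⟪x, (phiCLM (hT.summable i) ^ s) Z x⟫_ℂ = 0 := fun i s Z hZ => by
    induction s with
    | zero => exact hZ
    | succ s ih =>
      rw [pow_succ', mulCLM_apply]
      exact hstep i _ ih
  have hprod : ∀ s : Fin k → ℕ, ∀ x ∈ S,
      ⟪x, (List.ofFn fun i => phiCLM (hT.summable i) ^ s i).prod (defect f m T 1) x⟫_ℂ = 0 := by
    intro s
    rw [List.ofFn_eq_map]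
    induction List.finRange k with
    | nil => exact h0
    | cons i l ih =>
      rw [List.map_cons, List.prod_cons, mulCLM_apply]
      exact hpow i (s i) _ ih
  rw [powerDefect_eq_prod hT.summable, ← inner_conj_symm, map_eq_zero]
  refine apply_prod_eq_zero (fun i j => hT.commute_phiCLM i j) (fun i => hT.norm_phiCLM_le i) hm
    (vectorState h) 1 (fun s => ?_) q
  rw [mulCLM_apply, ← defect_eq_prod hT.summable]
  exact hprod s h hhS

end kernel

/-! ### The universal model -/

section model

open Classical in
theorem weightedShift_single {ι D : Type*} [NormedAddCommGroup D] [InnerProductSpace ℂ D]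
    (s : ι → ι) (hs : Function.Injective s) (c : ι → ℝ) (C : ℝ) (hc : ∀ β, |c β| ≤ C) (β : ι)
    (u : D) :
    weightedShift D s hs c C hc (lp.single 2 β u) = lp.single 2 (s β) ((c β : ℂ) • u) := by
  refine lp.ext (funext fun γ => ?_)
  by_cases h : ∃ δ, s δ = γ
  · obtain ⟨δ, rfl⟩ := h
    rw [weightedShift_apply]
    by_cases hδ : δ = β
    · subst hδ; simp
    · rw [lp.single_apply_ne _ _ _ hδ, lp.single_apply_ne _ _ _ (hs.ne hδ), smul_zero]
  · rw [lp.single_apply_ne _ _ _ fun h' => h ⟨β, h'.symm⟩]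
    exact Function.extend_apply' (fun δ => (c δ : ℂ) • (lp.single 2 β u : lp (fun _ : ι => D) 2) δ)
      (0 : ι → D) γ h

theorem adjoint_weightedShift_apply {ι D : Type*} [NormedAddCommGroup D] [InnerProductSpace ℂ D]
    [CompleteSpace D] (s : ι → ι) (hs : Function.Injective s) (c : ι → ℝ) (C : ℝ)
    (hc : ∀ β, |c β| ≤ C) (x : lp (fun _ : ι => D) 2) (β : ι) :
    (weightedShift D s hs c C hc).adjoint x β = (c β : ℂ) • x (s β) := by
  classical
  refine ext_inner_left ℂ fun u => ?_
  refine (lp.inner_single_left (G := fun _ : ι => D) β u _).symm.trans ?_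
  rw [ContinuousLinearMap.adjoint_inner_right, weightedShift_single, lp.inner_single_left,
    inner_smul_left, inner_smul_right, Complex.conj_ofReal]

variable {k : ℕ} {n : Fin k → ℕ} {m : Fin k → ℕ} {f : ∀ i, PositiveRegular (n i)}
  {D : Type*} [NormedAddCommGroup D] [InnerProductSpace ℂ D] [CompleteSpace D]

/-- The adjoint of `𝐖_{i,α} ⊗ I` deletes the prefix `α` of the `i`-th word. -/
theorem star_lift_universalModel_apply (i : Fin k) (α : FreeMonoid (Fin (n i))) (y : Fock n D)
    (β : Words n) : (star (FreeMonoid.lift (universalModel f m D i) α) y : Fock n D) β =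
      ((√((f i).b (m i) (β i)) / √((f i).b (m i) (α * β i)) : ℝ) : ℂ) •
        y (Function.update β i (α * β i)) := by
  induction α using FreeMonoid.recOn generalizing y with
  | one =>
    have hb : √((f i).b (m i) (β i)) ≠ 0 := (Real.sqrt_pos.mpr (b_pos _ _ _)).ne'
    simp only [map_one, star_one, one_mul, div_self hb, Complex.ofReal_one, one_smul,
      Function.update_eq_self]
    rfl
  | of_mul j α ih =>
    have hb : √((f i).b (m i) (α * β i)) ≠ 0 := (Real.sqrt_pos.mpr (b_pos _ _ _)).ne'
    have e : consWord i j (Function.update β i (α * β i)) =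
        Function.update β i (FreeMonoid.of j * α * β i) := by
      simp [consWord, mul_assoc]
    rw [map_mul, FreeMonoid.lift_eval_of, star_mul]
    refine (ih (star (universalModel f m D i j) y)).trans ?_
    have h1 := adjoint_weightedShift_apply (consWord i j) (consWord_injective i j)
      (fun β => √((f i).b (m i) (β i)) / √((f i).b (m i) (FreeMonoid.of j * β i)))
      (√(1 / (f i).coeff (FreeMonoid.of j))) (fun β => (f i).weight_le (m i) j (β i)) y
      (Function.update β i (α * β i))
    rw [e] at h1
    refine (congrArg _ h1).trans ?_
    rw [smul_smul, ← Complex.ofReal_mul, Function.update_self, mul_assoc, div_mul_div_cancel₀ hb]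

theorem adjoint_universalModel_apply (i : Fin k) (j : Fin (n i)) (y : Fock n D) (β : Words n) :
    ((universalModel f m D i j).adjoint y : Fock n D) β =
      ((√((f i).b (m i) (β i)) / √((f i).b (m i) (FreeMonoid.of j * β i)) : ℝ) : ℂ) •
        y (consWord i j β) :=
  adjoint_weightedShift_apply _ _ _ _ _ y β

theorem wordConv_b_le {N : ℕ} (g : PositiveRegular N) {m : ℕ} (hm : 1 ≤ m)
    (α : FreeMonoid (Fin N)) :
    wordConv g.coeff (g.b m) α ≤ g.b m α := by
  obtain ⟨r, rfl⟩ : ∃ r, m = r + 1 := ⟨m - 1, by omega⟩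
  rw [b_eq_invPow g hm, ← sub_nonneg, invPow_succ_sub]
  exact Finset.sum_nonneg fun p _ => mul_nonneg (negBinom_nonneg _ _) (convPow_nonneg g _ _)

theorem sum_coeff_mul_norm_universalModel_le (hm : ∀ i, 1 ≤ m i) (i : Fin k) (y : Fock n D)
    (F : Finset (FreeMonoid (Fin (n i)))) : ∑ α ∈ F, (f i).coeff α *
      ‖star (FreeMonoid.lift (universalModel f m D i) α) y‖ ^ 2 ≤ ‖y‖ ^ 2 := by
  rw [← ENNReal.ofReal_le_ofReal_iff (by positivity),
    ENNReal.ofReal_sum_of_nonneg fun α _ => mul_nonneg ((f i).coeff_nonneg α) (by positivity)]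
  refine (ENNReal.sum_le_tsum F).trans ?_
  have hn : ∀ x : Fock n D, ENNReal.ofReal (‖x‖ ^ 2) =
      ∑' β, ENNReal.ofReal (‖x β‖ ^ 2) := fun x => by
    rw [← (hasSum_sq x).tsum_eq, ENNReal.ofReal_tsum_of_nonneg (fun _ => by positivity)
      (hasSum_sq x).summable]
  let G : (Σ β : Words n, Fin ((β i).toList.length + 1)) → ℝ≥0∞ := fun x => ENNReal.ofReal
    ((f i).coeff (wordPrefix (x.1 i) x.2) * ((f i).b (m i) (wordSuffix (x.1 i) x.2) /
      (f i).b (m i) (x.1 i) * ‖y x.1‖ ^ 2))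
  let e : FreeMonoid (Fin (n i)) × Words n → (Σ β : Words n, Fin ((β i).toList.length + 1)) :=
    fun x => ⟨Function.update x.2 i (x.1 * x.2 i), ⟨x.1.toList.length, by
      rw [Function.update_self, FreeMonoid.toList_mul, List.length_append]
      omega⟩⟩
  have hpre : ∀ x, wordPrefix ((e x).1 i) (e x).2 = x.1 := fun x => by
    simp only [e, Function.update_self]
    exact wordPrefix_mul _ _
  have hsuf : ∀ x, wordSuffix ((e x).1 i) (e x).2 = x.2 i := fun x => by
    simp only [e, Function.update_self]
    exact wordSuffix_mul _ _
  have he : Function.Injective e := fun x x' h => by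
    have h1 : x.1 = x'.1 := by rw [← hpre x, ← hpre x', h]
    have h2 : x.2 i = x'.2 i := by rw [← hsuf x, ← hsuf x', h]
    refine Prod.ext h1 (funext fun l => ?_)
    by_cases hl : l = i
    · subst hl; exact h2
    · have := congrFun (congrArg Sigma.fst h) l
      simpa [e, hl] using this
  calc _ = ∑' α, ∑' β, G (e (α, β)) := by
        refine tsum_congr fun α => ?_
        rw [ENNReal.ofReal_mul ((f i).coeff_nonneg α), hn, ← ENNReal.tsum_mul_left]
        refine tsum_congr fun β => ?_
        rw [star_lift_universalModel_apply, ← ENNReal.ofReal_mul ((f i).coeff_nonneg α), norm_smul,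
          mul_pow, Complex.norm_real, Real.norm_eq_abs, sq_abs, div_pow,
          Real.sq_sqrt ((f i).b_nonneg _ _), Real.sq_sqrt ((f i).b_nonneg _ _)]
        simp only [G, hpre, hsuf]
        simp only [e, Function.update_self]
    _ = ∑' x, G (e x) := (ENNReal.tsum_prod (f := fun α β => G (e (α, β)))).symm
    _ ≤ ∑' x, G x := ENNReal.tsum_comp_le_tsum_of_injective he G
    _ = ∑' β, ∑ l : Fin ((β i).toList.length + 1), G ⟨β, l⟩ := by
        rw [ENNReal.tsum_sigma']
        exact tsum_congr fun β => tsum_fintype _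
    _ ≤ ∑' β, ENNReal.ofReal (‖y β‖ ^ 2) := by
        refine ENNReal.tsum_le_tsum fun β => ?_
        have hb := b_pos (f i) (m i) (β i)
        simp only [G]
        rw [← ENNReal.ofReal_sum_of_nonneg fun l _ => mul_nonneg ((f i).coeff_nonneg _)
          (mul_nonneg (div_nonneg ((f i).b_nonneg _ _) hb.le) (by positivity))]
        refine ENNReal.ofReal_le_ofReal ?_
        have h1 := wordConv_b_le (f i) (hm i) (β i)
        rw [wordConv, Finset.sum_range] at h1
        calc _ = (∑ l : Fin ((β i).toList.length + 1), (f i).coeff (wordPrefix (β i) l) *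
              (f i).b (m i) (wordSuffix (β i) l)) / (f i).b (m i) (β i) * ‖y β‖ ^ 2 := by
              rw [Finset.sum_div, Finset.sum_mul]
              exact Finset.sum_congr rfl fun l _ => by ring
          _ ≤ 1 * ‖y β‖ ^ 2 := by
              gcongr
              exact (div_le_one hb).mpr h1
          _ = _ := one_mul _
    _ = _ := (hn y).symm

theorem summable_phiTerm_universalModel (hm : ∀ i, 1 ≤ m i) (i : Fin k) :
    Summable (phiTerm (f i) (universalModel f m D i) 1) :=
  (hasSum_phiTerm_of_bound zero_le_one (fun y F => by
    rw [one_pow, one_mul]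
    exact sum_coeff_mul_norm_universalModel_le hm i y F) 1).1.summable

open Classical in
/-- `Z` is diagonal with entries `d_β` with respect to the decomposition into the spaces
`e_β ⊗ D`. -/
def IsDiagonal (Z : Fock n D →L[ℂ] Fock n D) (d : Words n → ℝ) : Prop :=
  ∀ β u, Z (lp.single 2 β u) = (d β : ℂ) • lp.single 2 β u

open Classical in
theorem star_lift_universalModel_single (i : Fin k) (α δ : FreeMonoid (Fin (n i))) (β : Words n)
    (hβ : β i = α * δ) (u : D) :
    (star (FreeMonoid.lift (universalModel f m D i) α) (lp.single 2 β u) : Fock n D) =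
      ((√((f i).b (m i) δ) / √((f i).b (m i) (β i)) : ℝ) : ℂ) •
        lp.single 2 (Function.update β i δ) u := by
  refine lp.ext (funext fun γ => ?_)
  rw [star_lift_universalModel_apply, lp.coeFn_smul, Pi.smul_apply]
  by_cases hγ : γ = Function.update β i δ
  · subst hγ
    have : Function.update (Function.update β i δ) i (α * Function.update β i δ i) = β := by
      simp [← hβ]
    rw [this, lp.single_apply_self, lp.single_apply_self, Function.update_self, hβ]
  · rw [lp.single_apply_ne _ _ _ hγ, lp.single_apply_ne _ _ _ fun h => hγ ?_, smul_zero, smul_zero]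
    have h1 := congrFun h i
    rw [Function.update_self, hβ] at h1
    rw [← h]
    simp [← mul_left_cancel h1]

open Classical in
theorem star_lift_universalModel_single_of_ne (i : Fin k) (α : FreeMonoid (Fin (n i)))
    (β : Words n) (hβ : ∀ δ, α * δ ≠ β i) (u : D) :
    (star (FreeMonoid.lift (universalModel f m D i) α) (lp.single 2 β u) : Fock n D) = 0 := by
  refine lp.ext (funext fun γ => ?_)
  rw [star_lift_universalModel_apply, lp.single_apply_ne _ _ _ fun h => hβ (γ i) ?_, smul_zero]
  · rfl
  · rw [← h, Function.update_self]

theorem IsDiagonal.phi (hm : ∀ i, 1 ≤ m i) (i : Fin k) {Z : Fock n D →L[ℂ] Fock n D}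
    {d : Words n → ℝ} (hZ : IsDiagonal Z d) :
    IsDiagonal (phi (f i) (universalModel f m D i) Z) fun β =>
      ∑ l ∈ Finset.range ((β i).toList.length + 1), (f i).coeff (wordPrefix (β i) l) *
        ((f i).b (m i) (wordSuffix (β i) l) / (f i).b (m i) (β i) *
          d (Function.update β i (wordSuffix (β i) l))) := by
  classical
  intro β u
  refine ext_inner_left ℂ fun g => ?_
  refine (hasSum_inner_phi (summable_phiTerm_universalModel hm i) Z _ g).unique ?_
  have hinj : Set.InjOn (wordPrefix (β i)) (Finset.range ((β i).toList.length + 1)) :=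
    fun l hl l' hl' h => by
      have hlen : ∀ l ∈ (Finset.range ((β i).toList.length + 1) : Set ℕ),
          (wordPrefix (β i) l).toList.length = l := fun l hl =>
        List.length_take_of_le (Nat.lt_succ_iff.mp (Finset.mem_range.mp hl))
      rw [← hlen l hl, ← hlen l' hl', h]
  have hzero : ∀ α, α ∉ (Finset.range ((β i).toList.length + 1)).image (wordPrefix (β i)) →
      ((f i).coeff α : ℂ) * ⟪star (FreeMonoid.lift (universalModel f m D i) α) g,
        Z (star (FreeMonoid.lift (universalModel f m D i) α) (lp.single 2 β u))⟫_ℂ = 0 := by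
    intro α hα
    rw [star_lift_universalModel_single_of_ne, map_zero, inner_zero_right, mul_zero]
    intro δ hδ
    refine hα (Finset.mem_image.mpr ⟨α.toList.length, Finset.mem_range.mpr ?_, ?_⟩)
    · rw [← hδ, FreeMonoid.toList_mul, List.length_append]
      omega
    · rw [← hδ, wordPrefix_mul]
  convert hasSum_sum_of_ne_finset_zero (L := .unconditional _) hzero using 1
  rw [Finset.sum_image hinj, inner_smul_right, Complex.ofReal_sum, Finset.sum_mul]
  refine Finset.sum_congr rfl fun l _ => ?_
  have hsplit := (wordPrefix_mul_wordSuffix (β i) l).symm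
  have hupd : Function.update (Function.update β i (wordSuffix (β i) l)) i
      (wordPrefix (β i) l * Function.update β i (wordSuffix (β i) l) i) = β := by
    rw [Function.update_self, ← hsplit]
    simp
  have hsq : (f i).b (m i) (wordSuffix (β i) l) / (f i).b (m i) (β i) =
      √((f i).b (m i) (wordSuffix (β i) l)) / √((f i).b (m i) (β i)) *
        (√((f i).b (m i) (wordSuffix (β i) l)) / √((f i).b (m i) (β i))) := by
    rw [div_mul_div_comm, Real.mul_self_sqrt ((f i).b_nonneg _ _),
      Real.mul_self_sqrt ((f i).b_nonneg _ _)]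
  rw [star_lift_universalModel_single i _ _ β hsplit, map_smul, hZ, inner_smul_right,
    inner_smul_right, lp.inner_single_right, lp.inner_single_right, star_lift_universalModel_apply,
    hupd, inner_smul_left, Function.update_self, ← hsplit, Complex.conj_ofReal, hsq]
  push_cast
  ring

omit [CompleteSpace D] in
theorem IsDiagonal.sub {Z Z' : Fock n D →L[ℂ] Fock n D} {d d' : Words n → ℝ}
    (hZ : IsDiagonal Z d) (hZ' : IsDiagonal Z' d') : IsDiagonal (Z - Z') (d - d') := by
  intro β u
  rw [sub_apply, hZ, hZ', Pi.sub_apply, Complex.ofReal_sub, sub_smul]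

/-- Applying `(id - Φ_i)^p` lowers the exponent in the coefficients of `(1 - f_i)^{-r}`. -/
theorem IsDiagonal.iterate (hm : ∀ i, 1 ≤ m i) (i : Fin k) {g : Words n → ℝ}
    (hg : ∀ β δ, g (Function.update β i δ) = g β) (p : ℕ) {r : ℕ} {Z : Fock n D →L[ℂ] Fock n D}
    (hZ : IsDiagonal Z fun β => g β * (invPow (f i) (r + p) (β i) / (f i).b (m i) (β i))) :
    IsDiagonal ((fun Y => Y - Polydomain.phi (f i) (universalModel f m D i) Y)^[p] Z) fun β =>
      g β * (invPow (f i) r (β i) / (f i).b (m i) (β i)) := by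
  induction p generalizing Z with
  | zero => exact hZ
  | succ p ih =>
    rw [Function.iterate_succ_apply]
    refine ih ?_
    have := hZ.sub (hZ.phi (f := f) hm i)
    convert this using 1
    funext β
    have hb : ∀ δ, (f i).b (m i) δ ≠ 0 := fun δ => (b_pos _ _ _).ne'
    rw [Pi.sub_apply, ← invPow_succ_sub, wordConv, add_assoc, sub_div, mul_sub, Finset.sum_div,
      Finset.mul_sum]
    congr 1
    refine Finset.sum_congr rfl fun l _ => ?_
    rw [hg, Function.update_self]
    have h1 := hb (wordSuffix (β i) l)
    have h2 := hb (β i)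
    field_simp

open Classical in
theorem isDiagonal_defect (hm : ∀ i, 1 ≤ m i) :
    IsDiagonal (defect f m (universalModel f m D) 1) fun β => if β = 1 then 1 else 0 := by
  have key : ∀ l : List (Fin k), l.Nodup →
      IsDiagonal ((l.map fun i => (fun Y => Y - phi (f i) (universalModel f m D i) Y)^[m i]).foldr
        (· ∘ ·) id (1 : Fock n D →L[ℂ] Fock n D)) fun β => if ∀ i ∈ l, β i = 1 then 1 else 0 := by
    intro l hl
    induction l with
    | nil => intro β u; simp
    | cons i l ih =>
      obtain ⟨hil, hl⟩ := List.nodup_cons.mp hl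
      rw [List.map_cons, List.foldr_cons, Function.comp_apply]
      have := IsDiagonal.iterate (f := f) (r := 0) hm i
        (g := fun β => if ∀ i ∈ l, β i = 1 then 1 else 0) (fun β δ => by
          have : ∀ i' ∈ l, Function.update β i δ i' = β i' := fun i' hi' =>
            Function.update_of_ne (fun h : i' = i => hil (h ▸ hi')) _ _
          refine if_congr (forall₂_congr fun i' hi' => by rw [this i' hi']) rfl rfl) (m i)
        (Z := (l.map fun i => (fun Y => Y - phi (f i) (universalModel f m D i) Y)^[m i]).foldr
        (· ∘ ·) id (1 : Fock n D →L[ℂ] Fock n D)) (by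
          convert ih hl using 2 with β
          rw [zero_add, ← b_eq_invPow _ (hm i), div_self (b_pos _ _ _).ne', mul_one])
      convert this using 2 with β
      rw [invPow_zero]
      by_cases h1 : β i = 1
      · simp [h1, (f i).b_one]
      · simp [h1]
  have := key (List.finRange k) (List.nodup_finRange k)
  unfold defect compAll
  rw [List.ofFn_eq_map]
  convert this using 2 with β
  simp [funext_iff]

/-- `Δ^m_{f,𝐖}(I)` is the orthogonal projection onto the vacuum space `e_{g_0} ⊗ D`. -/
theorem inner_defect_universalModel (hm : ∀ i, 1 ≤ m i) (x y : Fock n D) :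
    ⟪x, defect f m (universalModel f m D) 1 y⟫_ℂ = ⟪x 1, y 1⟫_ℂ := by
  classical
  have : defect f m (universalModel f m D) 1 =
      lp.singleContinuousLinearMap ℂ (fun _ : Words n => D) 2 1 ∘L
        lp.evalCLM ℂ (fun _ : Words n => D) 2 1 := by
    refine lp.ext_continuousLinearMap (by simp) fun β => ContinuousLinearMap.ext fun u => ?_
    refine (isDiagonal_defect hm β u).trans ?_
    by_cases hβ : β = 1
    · subst hβ
      refine (congrArg (fun c : ℝ => (c : ℂ) • (lp.single 2 1 u : Fock n D)) (if_pos rfl)).trans ?_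
      rw [Complex.ofReal_one, one_smul]
      exact congrArg (lp.single 2 (1 : Words n))
        (lp.single_apply_self (E := fun _ : Words n => D) 2 1 u).symm
    · beta_reduce
      rw [if_neg hβ, Complex.ofReal_zero, zero_smul]
      refine (lp.single_zero (E := fun _ : Words n => D) 2 1).symm.trans ?_
      exact congrArg (lp.single 2 (1 : Words n))
        (lp.single_apply_ne (E := fun _ : Words n => D) 2 β u (Ne.symm hβ)).symm
  rw [this]
  exact lp.inner_single_right (𝕜 := ℂ) (G := fun _ : Words n => D) (1 : Words n) (y 1) x

end model

/-- The Berezin kernel intertwines `T^*` and the adjoint of the universal model. -/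
theorem IsBerezinKernel.intertwines {k : ℕ} {n : Fin k → ℕ} {m : Fin k → ℕ}
    {f : ∀ i, PositiveRegular (n i)} {H : Type*} [NormedAddCommGroup H] [InnerProductSpace ℂ H]
    [CompleteSpace H] {T : OpTuple n H} (hc : ∀ p q, p ≠ q → ∀ s t, Commute (T p s) (T q t))
    {K : H →L[ℂ] Fock n (defectSpace f m T)} (hK : IsBerezinKernel f m T K) (i : Fin k)
    (j : Fin (n i)) (h : H) :
    K ((T i j).adjoint h) = (universalModel f m (defectSpace f m T) i j).adjoint (K h) := by
  refine lp.ext (funext fun β => Subtype.ext ?_)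
  rw [adjoint_universalModel_apply, Submodule.coe_smul, hK, hK]
  have h1 : starWord T (consWord i j β) h = starWord T β ((T i j).adjoint h) := by
    have := starWord_update hc i (FreeMonoid.of j) β
    rw [FreeMonoid.lift_eval_of] at this
    exact DFunLike.congr_fun this h
  refine Eq.trans ?_ (congrArg (fun z => (_ : ℂ) • (_ : ℂ) • posSqrt (defect f m T 1) z) h1.symm)
  rw [smul_smul, ← Complex.ofReal_mul]
  congr 2
  have hb : √((f i).b (m i) (FreeMonoid.of j * β i)) ≠ 0 := (Real.sqrt_pos.mpr (b_pos _ _ _)).ne'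
  rw [← Finset.mul_prod_erase _ _ (Finset.mem_univ i),
    ← Finset.mul_prod_erase _ (fun l => √((f l).b (m l) (consWord i j β l))) (Finset.mem_univ i),
    ← mul_assoc]
  congr 1
  · rw [consWord, Function.update_self, div_mul_cancel₀ _ hb]
  · refine Finset.prod_congr rfl fun l hl => ?_
    rw [consWord, Function.update_of_ne (Finset.ne_of_mem_erase hl)]

theorem IsBerezinKernel.apply_adjoint {k : ℕ} {n : Fin k → ℕ} {m : Fin k → ℕ}
    {f : ∀ i, PositiveRegular (n i)} {H : Type*} [NormedAddCommGroup H] [InnerProductSpace ℂ H]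
    [CompleteSpace H] {T : OpTuple n H} (hc : ∀ p q, p ≠ q → ∀ s t, Commute (T p s) (T q t))
    {K : H →L[ℂ] Fock n (defectSpace f m T)} (hK : IsBerezinKernel f m T K) (i : Fin k)
    (j : Fin (n i)) (x : Fock n (defectSpace f m T)) :
    T i j (K.adjoint x) = K.adjoint (universalModel f m (defectSpace f m T) i j x) := by
  refine ext_inner_left ℂ fun h => ?_
  rw [← ContinuousLinearMap.adjoint_inner_left, ContinuousLinearMap.adjoint_inner_right,
    ContinuousLinearMap.adjoint_inner_right, hK.intertwines hc,
    ContinuousLinearMap.adjoint_inner_left]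

/-! ### The model tuple -/

section sqrtRange

variable {H : Type*} [NormedAddCommGroup H] [InnerProductSpace ℂ H] [CompleteSpace H]
  {A : H →L[ℂ] H}

/-- The square root of a positive operator, with the closure of its range as codomain. -/
def sqrtRange (hA : 0 ≤ A) : H →L[ℂ] closedRange A :=
  (posSqrt A).codRestrict (closedRange A) (posSqrt_mem_closedRange hA)

theorem adjoint_sqrtRange (hA : 0 ≤ A) :
    (sqrtRange hA).adjoint = posSqrt A ∘L (closedRange A).subtypeL := by
  refine ContinuousLinearMap.ext fun y => ext_inner_left ℂ fun x => ?_
  rw [ContinuousLinearMap.adjoint_inner_right]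
  refine Eq.trans ?_ (ContinuousLinearMap.adjoint_inner_left (posSqrt A) (y : H) x)
  rw [posSqrt_isSelfAdjoint]
  rfl

theorem adjoint_sqrtRange_comp (hA : 0 ≤ A) : (sqrtRange hA).adjoint ∘L sqrtRange hA = A := by
  rw [adjoint_sqrtRange]
  exact ContinuousLinearMap.ext fun x => posSqrt_mul_self hA x

theorem denseRange_sqrtRange (hA : 0 ≤ A) : DenseRange (sqrtRange hA) := by
  rw [DenseRange, Topology.IsInducing.subtypeVal.dense_iff]
  rintro ⟨y, hy⟩
  refine closure_mono ?_ hy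
  rintro _ ⟨x, rfl⟩
  exact ⟨sqrtRange hA (posSqrt A x), ⟨_, rfl⟩, posSqrt_mul_self hA x⟩

end sqrtRange

section starWord

variable {k : ℕ} {n : Fin k → ℕ} {m : Fin k → ℕ} {f : ∀ i, PositiveRegular (n i)}

theorem starWord_of_intertwines {H G : Type*}
    [NormedAddCommGroup H] [InnerProductSpace ℂ H] [CompleteSpace H]
    [NormedAddCommGroup G] [InnerProductSpace ℂ G] [CompleteSpace G]
    {X : OpTuple n H} {X' : OpTuple n G} {J : H →L[ℂ] G}
    (hJ : ∀ i j, X' i j ∘L J = J ∘L X i j) (β : Words n) (g : G) :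
    J.adjoint (starWord X' β g) = starWord X β (J.adjoint g) := by
  unfold starWord
  rw [List.ofFn_eq_map, List.ofFn_eq_map]
  induction List.finRange k with
  | nil => rfl
  | cons i l ih =>
    rw [List.map_cons, List.map_cons, List.prod_cons, List.prod_cons, mulCLM_apply, mulCLM_apply,
      ← ih, adjoint_lift_of_intertwines (hJ i)]

/-- The `e_{g_0}`-coefficient of `𝐖_β^* y` is the `e_β`-coefficient of `y`, up to the weight. -/
theorem sqrtWeight_smul_starWord_universalModel {D : Type*} [NormedAddCommGroup D]
    [InnerProductSpace ℂ D] [CompleteSpace D] (β : Words n) (y : Fock n D) :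
    ((sqrtWeight f m β : ℝ) : ℂ) • (starWord (universalModel f m D) β y : Fock n D) 1 = y β := by
  classical
  have key : ∀ l : List (Fin k), l.Nodup → ∀ γ : Words n,
      ((l.map fun i => star (FreeMonoid.lift (universalModel f m D i) (β i))).prod y : Fock n D) γ =
        (((l.map fun i => √((f i).b (m i) (γ i)) / √((f i).b (m i) (β i * γ i))).prod : ℝ) : ℂ) •
          y (fun i => if i ∈ l then β i * γ i else γ i) := by
    intro l hl
    induction l with
    | nil => intro γ; simp
    | cons i l ih =>
      intro γ
      obtain ⟨hil, hl⟩ := List.nodup_cons.mp hl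
      rw [List.map_cons, List.prod_cons, List.map_cons, List.prod_cons, mulCLM_apply,
        star_lift_universalModel_apply, ih hl, smul_smul, ← Complex.ofReal_mul]
      have h1 : ∀ i' ∈ l, Function.update γ i (β i * γ i) i' = γ i' := fun i' hi' =>
        Function.update_of_ne (fun h : i' = i => hil (h ▸ hi')) _ _
      congr 3
      · refine congrArg List.prod (List.map_congr_left fun i' hi' => ?_)
        rw [h1 i' hi']
      · refine congrArg (y : Words n → D) (funext fun i' => ?_)
        by_cases h2 : i' = i
        · subst h2
          simp [hil]
        · simp [h2]
  have h := key (List.finRange k) (List.nodup_finRange k) 1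
  rw [← List.ofFn_eq_map, ← List.ofFn_eq_map, List.prod_ofFn] at h
  refine (congrArg _ h).trans ?_
  rw [smul_smul, ← Complex.ofReal_mul, sqrtWeight, ← Finset.prod_mul_distrib]
  have h2 : ∀ i, √((f i).b (m i) (β i)) *
      (√((f i).b (m i) ((1 : Words n) i)) / √((f i).b (m i) (β i * (1 : Words n) i))) = 1 :=
    fun i => by
      have : √((f i).b (m i) (β i)) ≠ 0 := (Real.sqrt_pos.mpr (b_pos _ _ _)).ne'
      rw [Pi.one_apply, mul_one, (f i).b_one, Real.sqrt_one, mul_one_div_cancel this]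
  rw [Finset.prod_congr rfl fun i _ => h2 i, Finset.prod_const_one, Complex.ofReal_one, one_smul]
  exact congrArg (y : Words n → D) (funext fun i => by simp)

end starWord

section compression

variable {k : ℕ} {n : Fin k → ℕ} {m : Fin k → ℕ} {f : ∀ i, PositiveRegular (n i)}
  {D : Type*} [NormedAddCommGroup D] [InnerProductSpace ℂ D] [CompleteSpace D]
  {E : Type*} [NormedAddCommGroup E] [InnerProductSpace ℂ E] [CompleteSpace E]
  {L : Type*} [NormedAddCommGroup L] [InnerProductSpace ℂ L] [CompleteSpace L]

theorem adjoint_comp_of_isMultiAnalytic {Ψ : Fock n E →L[ℂ] Fock n D}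
    (hM : IsMultiAnalytic f m Ψ) (i : Fin k) (j : Fin (n i)) (x : Fock n D) :
    Ψ.adjoint ((universalModel f m D i j).adjoint x) =
      (universalModel f m E i j).adjoint (Ψ.adjoint x) := by
  have := congrArg ContinuousLinearMap.adjoint (hM i j)
  rw [ContinuousLinearMap.adjoint_comp, ContinuousLinearMap.adjoint_comp] at this
  exact (DFunLike.congr_fun this x).symm

/-- A tuple `M` on a space `L` together with a factorization `Q^* Q = Ψ Ψ^*`, in which `Q` has dense
range and intertwines `𝐖^*` and `M^*`, while `Ψ` is multi-analytic.  For `Q = (I - K K^*)^{1/2}`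
this is the situation of the model tuple. -/
structure ModelFactorization (f : ∀ i, PositiveRegular (n i)) (m : Fin k → ℕ) (M : OpTuple n L)
    (Q : Fock n D →L[ℂ] L) (Ψ : Fock n E →L[ℂ] Fock n D) : Prop where
  dense : DenseRange Q
  adjoint_comp_self : Q.adjoint ∘L Q = Ψ ∘L Ψ.adjoint
  adjoint_apply : ∀ i j x, (M i j).adjoint (Q x) = Q ((universalModel f m D i j).adjoint x)
  multiAnalytic : IsMultiAnalytic f m Ψ

theorem norm_eq_of_adjoint_comp_self {Q : Fock n D →L[ℂ] L} {Ψ : Fock n E →L[ℂ] Fock n D}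
    (h : Q.adjoint ∘L Q = Ψ ∘L Ψ.adjoint) (x : Fock n D) : ‖Q x‖ = ‖Ψ.adjoint x‖ := by
  rw [← sq_eq_sq₀ (norm_nonneg _) (norm_nonneg _), ← inner_self_eq_norm_sq (𝕜 := ℂ),
    ← inner_self_eq_norm_sq (𝕜 := ℂ), ← ContinuousLinearMap.adjoint_inner_right,
    ContinuousLinearMap.adjoint_inner_left]
  exact congrArg (fun A : Fock n D →L[ℂ] Fock n D => RCLike.re ⟪x, A x⟫_ℂ) h

/-- If `Q^* Q = Ψ Ψ^*` with `Ψ` multi-analytic, then `‖Q 𝐖_{i,j}^* x‖ ≤ ‖𝐖_{i,j}‖ ‖Q x‖`, so that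
`Q x ↦ Q 𝐖_{i,j}^* x` defines a bounded operator. -/
theorem exists_comp_adjoint_universalModel {Q : Fock n D →L[ℂ] L} {Ψ : Fock n E →L[ℂ] Fock n D}
    (hd : DenseRange Q) (h : Q.adjoint ∘L Q = Ψ ∘L Ψ.adjoint) (hΨ : IsMultiAnalytic f m Ψ)
    (i : Fin k) (j : Fin (n i)) :
    ∃ N : L →L[ℂ] L, ∀ x, N (Q x) = Q ((universalModel f m D i j).adjoint x) := by
  refine ⟨(Q ∘L (universalModel f m D i j).adjoint).toLinearMap.extendOfNorm Q.toLinearMap,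
    LinearMap.extendOfNorm_eq (f := (Q ∘L (universalModel f m D i j).adjoint).toLinearMap)
      (e := Q.toLinearMap) hd ⟨‖(universalModel f m E i j).adjoint‖, fun x => ?_⟩⟩
  have h1 : ‖Q ((universalModel f m D i j).adjoint x)‖ ≤
      ‖(universalModel f m E i j).adjoint‖ * ‖Q x‖ := by
    rw [norm_eq_of_adjoint_comp_self h, norm_eq_of_adjoint_comp_self h,
      adjoint_comp_of_isMultiAnalytic hΨ]
    exact ContinuousLinearMap.le_opNorm _ _
  exact h1

namespace ModelFactorization

variable {M : OpTuple n L} {Q : Fock n D →L[ℂ] L} {Ψ : Fock n E →L[ℂ] Fock n D}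

theorem norm_eq (h : ModelFactorization f m M Q Ψ) (x : Fock n D) : ‖Q x‖ = ‖Ψ.adjoint x‖ :=
  norm_eq_of_adjoint_comp_self h.adjoint_comp_self x

theorem intertwines (h : ModelFactorization f m M Q Ψ) (i : Fin k) (j : Fin (n i)) :
    universalModel f m D i j ∘L Q.adjoint = Q.adjoint ∘L M i j := by
  have h1 : (M i j).adjoint ∘L Q = Q ∘L (universalModel f m D i j).adjoint :=
    ContinuousLinearMap.ext (h.adjoint_apply i j)
  have := congrArg ContinuousLinearMap.adjoint h1
  rw [ContinuousLinearMap.adjoint_comp, ContinuousLinearMap.adjoint_comp,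
    ContinuousLinearMap.adjoint_adjoint, ContinuousLinearMap.adjoint_adjoint] at this
  exact this.symm

theorem summable (h : ModelFactorization f m M Q Ψ) (hm : ∀ i, 1 ≤ m i) (i : Fin k) :
    Summable (phiTerm (f i) (M i) 1) := by
  refine (hasSum_phiTerm_of_bound zero_le_one (fun z F => ?_) 1).1.summable
  rw [one_pow, one_mul]
  refine h.dense.induction_on
    (p := fun z => ∑ α ∈ F, (f i).coeff α * ‖star (FreeMonoid.lift (M i) α) z‖ ^ 2 ≤ ‖z‖ ^ 2) z
    (isClosed_le (by fun_prop) (by fun_prop)) fun x => ?_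
  have h1 : ∀ α, ‖star (FreeMonoid.lift (M i) α) (Q x)‖ =
      ‖star (FreeMonoid.lift (universalModel f m E i) α) (Ψ.adjoint x)‖ := fun α => by
    have := adjoint_lift_of_intertwines (h.intertwines i) α x
    rw [ContinuousLinearMap.adjoint_adjoint] at this
    rw [← this, h.norm_eq,
      adjoint_lift_of_intertwines (J := Ψ) fun j => (h.multiAnalytic i j).symm]
  simp only [h1, h.norm_eq]
  exact sum_coeff_mul_norm_universalModel_le hm i _ F

/-- `Q^* Δ^m_{f,M}(I) Q = Δ^m_{f,𝐖}(Q^* Q) = Ψ Δ^m_{f,𝐖}(I) Ψ^*`, where `Δ^m_{f,𝐖}(I)` is the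
projection onto the vacuum space. -/
theorem inner_defect (h : ModelFactorization f m M Q Ψ) (hm : ∀ i, 1 ≤ m i) (x y : Fock n D) :
    ⟪Q x, defect f m M 1 (Q y)⟫_ℂ =
      ⟪(Ψ.adjoint x : Fock n E) 1, (Ψ.adjoint y : Fock n E) 1⟫_ℂ := by
  have h1 := defect_of_intertwines (h.summable hm) h.intertwines m 1
  have h2 := defect_of_intertwines (J := Ψ) (summable_phiTerm_universalModel hm)
    (fun i j => (h.multiAnalytic i j).symm) m 1
  have e : Q.adjoint ∘L 1 ∘L Q.adjoint.adjoint = Ψ ∘L 1 ∘L Ψ.adjoint := by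
    rw [ContinuousLinearMap.adjoint_adjoint]
    exact h.adjoint_comp_self
  rw [e] at h1
  have h3 := DFunLike.congr_fun (h1.symm.trans h2) y
  rw [ContinuousLinearMap.adjoint_adjoint] at h3
  rw [← ContinuousLinearMap.adjoint_inner_right, ← inner_defect_universalModel hm,
    ContinuousLinearMap.adjoint_inner_left]
  exact congrArg (inner ℂ x) h3

theorem defect_nonneg (h : ModelFactorization f m M Q Ψ) (hm : ∀ i, 1 ≤ m i) :
    0 ≤ defect f m M 1 := by
  rw [nonneg_iff_inner]
  intro z
  refine h.dense.induction_on (p := fun z => 0 ≤ ⟪z, defect f m M 1 z⟫_ℂ) z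
    (isClosed_le (by fun_prop) (by fun_prop)) fun x => ?_
  rw [h.inner_defect hm]
  rw [inner_self_eq_norm_sq_to_K]
  exact pow_nonneg (Complex.zero_le_real.mpr (norm_nonneg ((Ψ.adjoint x : Fock n E) 1))) 2

theorem norm_posSqrt_starWord (h : ModelFactorization f m M Q Ψ) (hm : ∀ i, 1 ≤ m i)
    (x : Fock n D) (β : Words n) :
    sqrtWeight f m β ^ 2 * ‖posSqrt (defect f m M 1) (starWord M β (Q x))‖ ^ 2 =
      ‖(Ψ.adjoint x : Fock n E) β‖ ^ 2 := by
  have h1 := starWord_of_intertwines h.intertwines β x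
  rw [ContinuousLinearMap.adjoint_adjoint] at h1
  rw [norm_posSqrt_sq (h.defect_nonneg hm), ← h1, h.inner_defect hm,
    starWord_of_intertwines (J := Ψ) fun i j => (h.multiAnalytic i j).symm, inner_self_eq_norm_sq,
    ← sqrtWeight_smul_starWord_universalModel (f := f) (m := m) β (Ψ.adjoint x), norm_smul, mul_pow,
    Complex.norm_real, Real.norm_eq_abs, sq_abs]

theorem isBerezinKernel (h : ModelFactorization f m M Q Ψ) (hm : ∀ i, 1 ≤ m i) :
    IsBerezinKernel f m M (berezinKernel f m M) := by
  refine isBerezinKernel_berezinKernel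
    (exists_isBerezinKernel (h.defect_nonneg hm) fun z F => ?_)
  refine h.dense.induction_on (p := fun z => ∑ β ∈ F, sqrtWeight f m β ^ 2 *
    ‖posSqrt (defect f m M 1) (starWord M β z)‖ ^ 2 ≤ ‖z‖ ^ 2) z
    (isClosed_le (by fun_prop) (by fun_prop)) fun x => ?_
  simp only [h.norm_posSqrt_starWord hm, h.norm_eq]
  exact sum_sq_le _ F

/-- The Berezin kernel of `M` is an isometry. -/
theorem norm_berezinKernel (h : ModelFactorization f m M Q Ψ) (hm : ∀ i, 1 ≤ m i) (z : L) :
    ‖berezinKernel f m M z‖ = ‖z‖ := by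
  have hK := h.isBerezinKernel hm
  refine h.dense.induction_on (p := fun z => ‖berezinKernel f m M z‖ = ‖z‖) z
    (isClosed_eq (by fun_prop) (by fun_prop)) fun x => ?_
  rw [h.norm_eq, ← sq_eq_sq₀ (norm_nonneg _) (norm_nonneg _)]
  have h1 : ∀ β, ‖(berezinKernel f m M (Q x) : Fock n (defectSpace f m M)) β‖ ^ 2 =
      ‖(Ψ.adjoint x : Fock n E) β‖ ^ 2 := fun β => by
    rw [← h.norm_posSqrt_starWord hm, ← Submodule.norm_coe, hK, norm_smul, mul_pow,
      Complex.norm_real, Real.norm_eq_abs, sq_abs]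
    rfl
  have h2 := hasSum_sq (berezinKernel f m M (Q x))
  simp only [h1] at h2
  exact h2.unique (hasSum_sq (Ψ.adjoint x))

end ModelFactorization

end compression

section isometricModel

variable {k : ℕ} {n : Fin k → ℕ}
  {D : Type*} [NormedAddCommGroup D] [InnerProductSpace ℂ D] [CompleteSpace D]
  {E : Type*} [NormedAddCommGroup E] [InnerProductSpace ℂ E] [CompleteSpace E]
  {L : Type*} [NormedAddCommGroup L] [InnerProductSpace ℂ L] [CompleteSpace L]

/-- A tuple `M` whose adjoint is the image of `𝐖^*` under an operator `Q` with dense range, and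
whose Berezin kernel exists and is an isometry. -/
structure IsIsometricModel (f : ∀ i, PositiveRegular (n i)) (m : Fin k → ℕ) (M : OpTuple n L)
    (Q : Fock n D →L[ℂ] L) : Prop where
  dense : DenseRange Q
  adjoint_apply : ∀ i j x, (M i j).adjoint (Q x) = Q ((universalModel f m D i j).adjoint x)
  summable : ∀ i, Summable (phiTerm (f i) (M i) 1)
  defect_nonneg : 0 ≤ defect f m M 1
  isBerezinKernel : IsBerezinKernel f m M (berezinKernel f m M)
  norm_berezinKernel : ∀ z, ‖berezinKernel f m M z‖ = ‖z‖

theorem ModelFactorization.isIsometricModel {f : ∀ i, PositiveRegular (n i)} {m : Fin k → ℕ}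
    {M : OpTuple n L} {Q : Fock n D →L[ℂ] L} {Ψ : Fock n E →L[ℂ] Fock n D}
    (h : ModelFactorization f m M Q Ψ) (hm : ∀ i, 1 ≤ m i) : IsIsometricModel f m M Q where
  dense := h.dense
  adjoint_apply := h.adjoint_apply
  summable := h.summable hm
  defect_nonneg := h.defect_nonneg hm
  isBerezinKernel := h.isBerezinKernel hm
  norm_berezinKernel := h.norm_berezinKernel hm

end isometricModel

section characteristicFunction

universe u

variable {k : ℕ} {n : Fin k → ℕ} {m : Fin k → ℕ} {f : ∀ i, PositiveRegular (n i)}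
  {H : Type u} [NormedAddCommGroup H] [InnerProductSpace ℂ H] [CompleteSpace H] {T : OpTuple n H}

theorem isModelTuple_iff (hY : 0 ≤ complementary f m T) {M : OpTuple n (modelSpace f m T)} :
    IsModelTuple f m T M ↔ ∀ i j x, (M i j).adjoint (sqrtRange hY x) =
      sqrtRange hY ((universalModel f m (defectSpace f m T) i j).adjoint x) := by
  refine ⟨fun h i j x => Subtype.ext (h i j x (sqrtRange hY x) rfl), fun h i j x y hy => ?_⟩
  obtain rfl : y = sqrtRange hY x := Subtype.ext hy
  exact congrArg Subtype.val (h i j x)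

theorem HasCharacteristicFunction.complementary_nonneg (hT : HasCharacteristicFunction f m T) :
    0 ≤ complementary f m T := by
  obtain ⟨-, E, _, _, _, Ψ, -, hΨ⟩ := hT
  rw [complementary, ← hΨ, add_sub_cancel_left, ContinuousLinearMap.nonneg_iff_isPositive]
  exact ContinuousLinearMap.isPositive_self_comp_adjoint Ψ

/-- A tuple that admits a characteristic function has a model tuple, whose Berezin kernel is an
isometry. -/
theorem HasCharacteristicFunction.isIsometricModel (hT : HasCharacteristicFunction f m T)
    (hm : ∀ i, 1 ≤ m i) :
    IsIsometricModel f m (modelTuple f m T) (sqrtRange hT.complementary_nonneg) := by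
  have hY := hT.complementary_nonneg
  obtain ⟨-, E, _, _, _, Ψ, hΨm, hΨ⟩ := hT
  have hYΨ : (sqrtRange hY).adjoint ∘L sqrtRange hY = Ψ ∘L Ψ.adjoint := by
    rw [adjoint_sqrtRange_comp, complementary, ← hΨ, add_sub_cancel_left]
  choose N hN using
    exists_comp_adjoint_universalModel (f := f) (m := m) (denseRange_sqrtRange hY) hYΨ hΨm
  have hex : ∃ M, IsModelTuple f m T M := ⟨fun i j => (N i j).adjoint,
    (isModelTuple_iff hY).mpr fun i j x => by rw [ContinuousLinearMap.adjoint_adjoint, hN]⟩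
  have hM : IsModelTuple f m T (modelTuple f m T) := by
    rw [modelTuple, dif_pos hex]
    exact hex.choose_spec
  exact ModelFactorization.isIsometricModel
    ⟨denseRange_sqrtRange hY, hYΨ, (isModelTuple_iff hY).mp hM, hΨm⟩ hm

end characteristicFunction

/-! ### Unitary equivalence -/

section unitary

variable {E E' F F' : Type*} [NormedAddCommGroup E] [InnerProductSpace ℂ E]
  [NormedAddCommGroup E'] [InnerProductSpace ℂ E']
  [NormedAddCommGroup F] [InnerProductSpace ℂ F]
  [NormedAddCommGroup F'] [InnerProductSpace ℂ F']

theorem mem_closedRange_of_unitary {A : E →L[ℂ] E} {A' : E' →L[ℂ] E'} (U : E ≃ₗᵢ[ℂ] E')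
    (h : ∀ x, A' (U x) = U (A x)) {y : E} (hy : y ∈ closedRange A) : U y ∈ closedRange A' := by
  refine map_mem_closure U.continuous hy ?_
  rintro _ ⟨x, rfl⟩
  exact ⟨U x, h x⟩

/-- A unitary operator that intertwines `A` and `A'` restricts to a unitary operator between the
closures of their ranges. -/
theorem exists_unitary_closedRange {A : E →L[ℂ] E} {A' : E' →L[ℂ] E'} (U : E ≃ₗᵢ[ℂ] E')
    (h : ∀ x, A' (U x) = U (A x)) :
    ∃ τ : closedRange A ≃ₗᵢ[ℂ] closedRange A', ∀ y, (τ y : E') = U y := by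
  let J : closedRange A →ₗᵢ[ℂ] closedRange A' :=
    ⟨(U.toLinearEquiv.toLinearMap ∘ₗ (closedRange A).subtype).codRestrict (closedRange A')
      fun y => mem_closedRange_of_unitary U h y.2, fun y => U.norm_map y⟩
  have hs : ∀ x, A (U.symm x) = U.symm (A' x) := fun x => by
    rw [LinearIsometryEquiv.eq_symm_apply, ← h, U.apply_symm_apply]
  refine ⟨LinearIsometryEquiv.ofSurjective J fun y => ⟨⟨U.symm y,
    mem_closedRange_of_unitary U.symm hs y.2⟩, Subtype.ext (U.apply_symm_apply y)⟩, fun y => rfl⟩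

/-- The unitary operator `I ⊗ τ`. -/
def idTensorEquiv (ι : Type*) (τ : E ≃ₗᵢ[ℂ] F) :
    lp (fun _ : ι => E) 2 ≃ₗᵢ[ℂ] lp (fun _ : ι => F) 2 :=
  LinearIsometryEquiv.ofSurjective (idTensor ι τ) fun y =>
    ⟨idTensor ι τ.symm y, lp.ext (funext fun β => τ.apply_symm_apply (y β))⟩

variable [CompleteSpace F] [CompleteSpace F']

theorem exists_unitary_of_norm_eq {Q : E →L[ℂ] F} {Q' : E' →L[ℂ] F'} (V : E ≃ₗᵢ[ℂ] E')
    (hQ : DenseRange Q) (hQ' : DenseRange Q') (h : ∀ x, ‖Q' (V x)‖ = ‖Q x‖) :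
    ∃ U : F ≃ₗᵢ[ℂ] F', ∀ x, U (Q x) = Q' (V x) :=
  ⟨V.toLinearEquiv.extendOfIsometry Q.toLinearMap Q'.toLinearMap hQ hQ' h,
    V.toLinearEquiv.extendOfIsometry_eq Q.toLinearMap Q'.toLinearMap hQ hQ' h⟩

variable [CompleteSpace E] [CompleteSpace E']

theorem adjoint_apply_of_unitary {A : E →L[ℂ] F} {A' : E' →L[ℂ] F'} (U : E ≃ₗᵢ[ℂ] E')
    (V : F ≃ₗᵢ[ℂ] F') (h : ∀ x, A' (U x) = V (A x)) (y : F) :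
    A'.adjoint (V y) = U (A.adjoint y) := by
  refine ext_inner_left ℂ fun w => ?_
  obtain ⟨w, rfl⟩ := U.surjective w
  rw [ContinuousLinearMap.adjoint_inner_right, h, V.inner_map_map, U.inner_map_map,
    ContinuousLinearMap.adjoint_inner_right]

theorem denseRange_adjoint_of_injective {K : E →L[ℂ] F} (hK : Function.Injective K) :
    DenseRange K.adjoint := by
  have h1 := ContinuousLinearMap.orthogonal_range K.adjoint
  rw [ContinuousLinearMap.adjoint_adjoint, LinearMap.ker_eq_bot.mpr hK,
    ← Submodule.topologicalClosure_eq_top_iff] at h1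
  exact Submodule.dense_iff_topologicalClosure_eq_top.mpr h1

theorem posSqrt_unitary {A : E →L[ℂ] E} {A' : E' →L[ℂ] E'} (U : E ≃ₗᵢ[ℂ] E') (hA : 0 ≤ A)
    (h : ∀ x, A' (U x) = U (A x)) (x : E) : posSqrt A' (U x) = U (posSqrt A x) := by
  let J : E →L[ℂ] E' := U.toContinuousLinearEquiv
  have hJ : ∀ y, J.adjoint y = U.symm y := fun y =>
    DFunLike.congr_fun U.adjoint_eq_symm y
  have hs : posSqrt A' = J ∘L posSqrt A ∘L J.adjoint := by
    refine CFC.sqrt_unique (ContinuousLinearMap.ext fun y => ?_) ?_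
    · obtain ⟨y, rfl⟩ := U.surjective y
      change J (posSqrt A (J.adjoint (J (posSqrt A (J.adjoint (U y)))))) = A' (U y)
      rw [hJ, hJ, U.symm_apply_apply, h, ← posSqrt_mul_self hA]
      exact congrArg (fun z => U (posSqrt A z)) (U.symm_apply_apply _)
    · rw [nonneg_iff_inner]
      intro y
      change 0 ≤ ⟪y, J (posSqrt A (J.adjoint y))⟫_ℂ
      rw [← ContinuousLinearMap.adjoint_inner_left]
      exact nonneg_iff_inner.mp (CFC.sqrt_nonneg A) _
  rw [hs]
  change J (posSqrt A (J.adjoint (U x))) = _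
  rw [hJ, U.symm_apply_apply]
  rfl

end unitary

section invariance

variable {k : ℕ} {n : Fin k → ℕ} {m : Fin k → ℕ} {f : ∀ i, PositiveRegular (n i)}
  {H : Type*} [NormedAddCommGroup H] [InnerProductSpace ℂ H] [CompleteSpace H]
  {H' : Type*} [NormedAddCommGroup H'] [InnerProductSpace ℂ H'] [CompleteSpace H']
  {T : OpTuple n H} {T' : OpTuple n H'}

theorem adjoint_universalModel_idTensorEquiv {D D' : Type*} [NormedAddCommGroup D]
    [InnerProductSpace ℂ D] [CompleteSpace D] [NormedAddCommGroup D'] [InnerProductSpace ℂ D']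
    [CompleteSpace D'] (τ : D ≃ₗᵢ[ℂ] D') (i : Fin k) (j : Fin (n i)) (x : Fock n D) :
    (universalModel f m D' i j).adjoint (idTensorEquiv (Words n) τ x) =
      idTensorEquiv (Words n) τ ((universalModel f m D i j).adjoint x) := by
  refine lp.ext (funext fun β => ?_)
  rw [adjoint_universalModel_apply]
  refine Eq.trans ?_ (congrArg τ (adjoint_universalModel_apply (f := f) (m := m) i j x β)).symm
  rw [map_smul]
  rfl

theorem universalModel_idTensorEquiv {D D' : Type*} [NormedAddCommGroup D]
    [InnerProductSpace ℂ D] [CompleteSpace D] [NormedAddCommGroup D'] [InnerProductSpace ℂ D']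
    [CompleteSpace D'] (τ : D ≃ₗᵢ[ℂ] D') (i : Fin k) (j : Fin (n i)) (x : Fock n D) :
    universalModel f m D' i j (idTensorEquiv (Words n) τ x) =
      idTensorEquiv (Words n) τ (universalModel f m D i j x) := by
  have := adjoint_apply_of_unitary _ _
    (adjoint_universalModel_idTensorEquiv (f := f) (m := m) τ i j) x
  rwa [ContinuousLinearMap.adjoint_adjoint, ContinuousLinearMap.adjoint_adjoint] at this

theorem defect_unitary (hX : ∀ i, Summable (phiTerm (f i) (T i) 1)) (U : H ≃ₗᵢ[ℂ] H')
    (hU : ∀ i j h, U (T i j h) = T' i j (U h)) (h : H) :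
    defect f m T' 1 (U h) = U (defect f m T 1 h) := by
  let J : H →L[ℂ] H' := U.toContinuousLinearEquiv
  have hJ : ∀ y, J.adjoint y = U.symm y := fun y => DFunLike.congr_fun U.adjoint_eq_symm y
  have h1 : J ∘L 1 ∘L J.adjoint = 1 := ContinuousLinearMap.ext fun y =>
    (congrArg U (hJ y)).trans (U.apply_symm_apply y)
  have h2 := defect_of_intertwines hX (X' := T') (J := J)
    (fun i j => ContinuousLinearMap.ext fun h => (hU i j h).symm) m 1
  rw [h1] at h2
  rw [h2]
  change U (defect f m T 1 (J.adjoint (U h))) = _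
  rw [hJ, U.symm_apply_apply]

/-- The Berezin kernels of unitarily equivalent tuples agree up to a unitary change of the
coefficient space. -/
theorem exists_berezinKernel_unitary (hX : ∀ i, Summable (phiTerm (f i) (T i) 1))
    (hΔ : 0 ≤ defect f m T 1) (hK : IsBerezinKernel f m T (berezinKernel f m T))
    (U : H ≃ₗᵢ[ℂ] H') (hU : ∀ i j h, U (T i j h) = T' i j (U h)) :
    ∃ τ : defectSpace f m T ≃ₗᵢ[ℂ] defectSpace f m T',
      ∀ h, berezinKernel f m T' (U h) = idTensorEquiv (Words n) τ (berezinKernel f m T h) := by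
  have hd := defect_unitary (m := m) hX U hU
  obtain ⟨τ, hτ⟩ := exists_unitary_closedRange U hd
  let J : H →L[ℂ] H' := U.toContinuousLinearEquiv
  have hJ : ∀ y, J.adjoint y = U.symm y := fun y => DFunLike.congr_fun U.adjoint_eq_symm y
  have hw : ∀ β h, starWord T' β (U h) = U (starWord T β h) := fun β h => by
    have := starWord_of_intertwines (X := T) (X' := T') (J := J)
      (fun i j => ContinuousLinearMap.ext fun h => (hU i j h).symm) β (U h)
    rw [hJ, hJ, U.symm_apply_apply] at this
    rw [← this, U.apply_symm_apply]
  let K' : H' →L[ℂ] Fock n (defectSpace f m T') :=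
    ((idTensorEquiv (Words n) τ).toContinuousLinearEquiv : _ →L[ℂ] _) ∘L berezinKernel f m T ∘L
      (U.symm.toContinuousLinearEquiv : H' →L[ℂ] H)
  have hK' : IsBerezinKernel f m T' K' := fun h β => by
    obtain ⟨h, rfl⟩ := U.surjective h
    have h1 : K' (U h) = idTensorEquiv (Words n) τ (berezinKernel f m T h) :=
      congrArg (fun z => idTensorEquiv (Words n) τ (berezinKernel f m T z)) (U.symm_apply_apply h)
    rw [h1]
    refine (hτ _).trans ?_
    rw [hK, map_smul]
    congr 1
    rw [← posSqrt_unitary U hΔ hd]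
    exact congrArg (posSqrt (defect f m T' 1)) (hw β h).symm
  refine ⟨τ, fun h => ?_⟩
  rw [(isBerezinKernel_berezinKernel ⟨K', hK'⟩).unique hK']
  exact congrArg (fun z => idTensorEquiv (Words n) τ (berezinKernel f m T z))
    (U.symm_apply_apply h)

end invariance

/-! ### The characteristic function as a complete unitary invariant -/

section invariant

variable {k : ℕ} {n : Fin k → ℕ} {m : Fin k → ℕ} {f : ∀ i, PositiveRegular (n i)}
  {H : Type*} [NormedAddCommGroup H] [InnerProductSpace ℂ H] [CompleteSpace H]
  {H' : Type*} [NormedAddCommGroup H'] [InnerProductSpace ℂ H'] [CompleteSpace H']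
  {D : Type*} [NormedAddCommGroup D] [InnerProductSpace ℂ D] [CompleteSpace D]
  {D' : Type*} [NormedAddCommGroup D'] [InnerProductSpace ℂ D'] [CompleteSpace D']
  {L : Type*} [NormedAddCommGroup L] [InnerProductSpace ℂ L] [CompleteSpace L]
  {L' : Type*} [NormedAddCommGroup L'] [InnerProductSpace ℂ L'] [CompleteSpace L']
  {T : OpTuple n H} {T' : OpTuple n H'} {M : OpTuple n L} {M' : OpTuple n L'}

/-- Two isometric models over unitarily equivalent maps `Q` are unitarily equivalent. -/
theorem IsIsometricModel.exists_unitary {Q : Fock n D →L[ℂ] L} {Q' : Fock n D' →L[ℂ] L'}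
    (hM : IsIsometricModel f m M Q) (hM' : IsIsometricModel f m M' Q') (τ : D ≃ₗᵢ[ℂ] D')
    (h : ∀ x, ‖Q' (idTensorEquiv (Words n) τ x)‖ = ‖Q x‖) :
    ∃ σ : L ≃ₗᵢ[ℂ] L', (∀ x, σ (Q x) = Q' (idTensorEquiv (Words n) τ x)) ∧
      ∀ i j z, σ (M i j z) = M' i j (σ z) := by
  obtain ⟨σ, hσ⟩ := exists_unitary_of_norm_eq (idTensorEquiv (Words n) τ) hM.dense hM'.dense h
  refine ⟨σ, hσ, fun i j z => ?_⟩
  have h1 : ∀ z, (M' i j).adjoint (σ z) = σ ((M i j).adjoint z) := fun z => by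
    refine hM.dense.induction_on
      (p := fun z => (M' i j).adjoint (σ z) = σ ((M i j).adjoint z)) z
      (isClosed_eq (by fun_prop) (by fun_prop)) fun x => ?_
    rw [hσ, hM'.adjoint_apply, adjoint_universalModel_idTensorEquiv, ← hσ, hM.adjoint_apply]
  have h2 := adjoint_apply_of_unitary σ σ h1 z
  rw [ContinuousLinearMap.adjoint_adjoint, ContinuousLinearMap.adjoint_adjoint] at h2
  exact h2.symm

/-- If `Q^* Q = I - K K^*`, then `‖Q x‖² + ‖K^* x‖² = ‖x‖²`. -/
theorem norm_sq_add_norm_adjoint_sq {Q : D →L[ℂ] L} {K : H →L[ℂ] D} {A : D →L[ℂ] D}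
    (hQ : Q.adjoint ∘L Q = A) (hA : A = 1 - K ∘L K.adjoint) (x : D) :
    ‖Q x‖ ^ 2 + ‖K.adjoint x‖ ^ 2 = ‖x‖ ^ 2 := by
  have h1 : ⟪Q x, Q x⟫_ℂ = ⟪x, x - K (K.adjoint x)⟫_ℂ := by
    rw [← ContinuousLinearMap.adjoint_inner_right]
    exact congrArg (fun A : D →L[ℂ] D => ⟪x, A x⟫_ℂ) (hQ.trans hA)
  have h2 : ⟪x, K (K.adjoint x)⟫_ℂ = ⟪K.adjoint x, K.adjoint x⟫_ℂ :=
    (ContinuousLinearMap.adjoint_inner_left K (K.adjoint x) x).symm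
  rw [inner_sub_right, h2] at h1
  rw [← inner_self_eq_norm_sq (𝕜 := ℂ) (Q x), h1, map_sub, inner_self_eq_norm_sq,
    inner_self_eq_norm_sq, sub_add_cancel]

omit [CompleteSpace L] [CompleteSpace L'] in
theorem norm_eq_iff_norm_adjoint_eq {Q : D →L[ℂ] L} {Q' : D' →L[ℂ] L'} {K : H →L[ℂ] D}
    {K' : H' →L[ℂ] D'} (hn : ∀ x, ‖Q x‖ ^ 2 + ‖K.adjoint x‖ ^ 2 = ‖x‖ ^ 2)
    (hn' : ∀ x, ‖Q' x‖ ^ 2 + ‖K'.adjoint x‖ ^ 2 = ‖x‖ ^ 2) (V : D ≃ₗᵢ[ℂ] D') (x : D) :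
    ‖Q' (V x)‖ = ‖Q x‖ ↔ ‖K'.adjoint (V x)‖ = ‖K.adjoint x‖ := by
  have h1 := hn' (V x)
  rw [V.norm_map, ← hn x] at h1
  rw [← sq_eq_sq₀ (norm_nonneg _) (norm_nonneg _),
    ← sq_eq_sq₀ (norm_nonneg (K'.adjoint _)) (norm_nonneg _)]
  constructor <;> intro h <;> linarith

/-- Since `T K^* = K^* 𝐖` and `K^*` has dense range, `K^* x ↦ K'^* (I ⊗ τ) x` extends to a unitary
equivalence as soon as it preserves norms. -/
theorem unitarilyEquivalent_of_norm_adjoint_eq {K : H →L[ℂ] Fock n D} {K' : H' →L[ℂ] Fock n D'}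
    (hK : Function.Injective K) (hK' : Function.Injective K')
    (hT : ∀ i j x, T i j (K.adjoint x) = K.adjoint (universalModel f m D i j x))
    (hT' : ∀ i j x, T' i j (K'.adjoint x) = K'.adjoint (universalModel f m D' i j x))
    (τ : D ≃ₗᵢ[ℂ] D') (h : ∀ x, ‖K'.adjoint (idTensorEquiv (Words n) τ x)‖ = ‖K.adjoint x‖) :
    UnitarilyEquivalent T T' := by
  have hd := denseRange_adjoint_of_injective hK
  obtain ⟨U, hU⟩ := exists_unitary_of_norm_eq (idTensorEquiv (Words n) τ) hd
    (denseRange_adjoint_of_injective hK') h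
  refine ⟨U, fun i j z => ?_⟩
  refine hd.induction_on (p := fun z => U (T i j z) = T' i j (U z)) z
    (isClosed_eq (by fun_prop) (by fun_prop)) fun x => ?_
  rw [hT, hU, hU, hT', universalModel_idTensorEquiv]

/-- For `Θ = Q^* B^*` with an isometry `B`, coincidence of `Θ` and `Θ'` is seen by `Q` and `Q'`:
`‖Θ^* x‖ = ‖B Q x‖ = ‖Q x‖`. -/
theorem norm_eq_of_coincide {G G' : Type*} [NormedAddCommGroup G] [InnerProductSpace ℂ G]
    [CompleteSpace G] [NormedAddCommGroup G'] [InnerProductSpace ℂ G'] [CompleteSpace G']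
    {Q : Fock n D →L[ℂ] L} {Q' : Fock n D' →L[ℂ] L'} {B : L →L[ℂ] Fock n G}
    {B' : L' →L[ℂ] Fock n G'} (hB : ∀ z, ‖B z‖ = ‖z‖) (hB' : ∀ z, ‖B' z‖ = ‖z‖) (τ₁ : G ≃ₗᵢ[ℂ] G')
    (τ₂ : D ≃ₗᵢ[ℂ] D')
    (h : ∀ x, (Q'.adjoint ∘L B'.adjoint) (idTensorEquiv (Words n) τ₁ x) =
      idTensorEquiv (Words n) τ₂ ((Q.adjoint ∘L B.adjoint) x)) (x : Fock n D) :
    ‖Q' (idTensorEquiv (Words n) τ₂ x)‖ = ‖Q x‖ := by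
  have h1 := adjoint_apply_of_unitary (idTensorEquiv (Words n) τ₁) (idTensorEquiv (Words n) τ₂) h x
  simp only [ContinuousLinearMap.adjoint_comp, ContinuousLinearMap.adjoint_adjoint,
    ContinuousLinearMap.comp_apply] at h1
  rw [← hB', h1, LinearIsometryEquiv.norm_map, hB]

theorem coincide_of_unitary {G G' : Type*} [NormedAddCommGroup G] [InnerProductSpace ℂ G]
    [CompleteSpace G] [NormedAddCommGroup G'] [InnerProductSpace ℂ G'] [CompleteSpace G']
    {Q : Fock n D →L[ℂ] L} {Q' : Fock n D' →L[ℂ] L'} {B : L →L[ℂ] Fock n G}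
    {B' : L' →L[ℂ] Fock n G'} (τ₁ : G ≃ₗᵢ[ℂ] G') (τ₂ : D ≃ₗᵢ[ℂ] D') (σ : L ≃ₗᵢ[ℂ] L')
    (hQ : ∀ x, σ (Q x) = Q' (idTensorEquiv (Words n) τ₂ x))
    (hB : ∀ z, B' (σ z) = idTensorEquiv (Words n) τ₁ (B z)) :
    Coincide (Q.adjoint ∘L B.adjoint) (Q'.adjoint ∘L B'.adjoint) := by
  refine ⟨τ₁, τ₂, fun x => ?_⟩
  have h1 := adjoint_apply_of_unitary σ (idTensorEquiv (Words n) τ₁) hB x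
  have h2 := adjoint_apply_of_unitary (idTensorEquiv (Words n) τ₂) σ (fun x => (hQ x).symm)
    (B.adjoint x)
  exact (congrArg Q'.adjoint h1).trans h2

/-- The characteristic function `Q^* K_M^*`, where `Q^* Q = I - K_T K_T^*`, determines the tuple up
to unitary equivalence.  The adjoints of `Q` and `Q'` are given names, because for the square roots
of `I - K_T K_T^*` they appear as square roots preceded by an inclusion. -/
theorem unitarilyEquivalent_iff_coincide (hm : ∀ i, 1 ≤ m i)
    (hT : CompletelyNonCoisometric f m T) (hT' : CompletelyNonCoisometric f m T')
    {Q : Fock n (defectSpace f m T) →L[ℂ] L} {Q' : Fock n (defectSpace f m T') →L[ℂ] L'}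
    {R : L →L[ℂ] Fock n (defectSpace f m T)} {R' : L' →L[ℂ] Fock n (defectSpace f m T')}
    (hR : Q.adjoint = R) (hR' : Q'.adjoint = R')
    (hQ : Q.adjoint ∘L Q = complementary f m T) (hQ' : Q'.adjoint ∘L Q' = complementary f m T')
    (hM : IsIsometricModel f m M Q) (hM' : IsIsometricModel f m M' Q') :
    UnitarilyEquivalent T T' ↔ Coincide (R ∘L (berezinKernel f m M).adjoint)
      (R' ∘L (berezinKernel f m M').adjoint) := by
  subst hR hR'
  have hn := norm_sq_add_norm_adjoint_sq hQ rfl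
  have hn' := norm_sq_add_norm_adjoint_sq hQ' rfl
  have hK := hT.1.isBerezinKernel hm
  have hK' := hT'.1.isBerezinKernel hm
  constructor
  · rintro ⟨U, hU⟩
    obtain ⟨τ₂, h₂⟩ :=
      exists_berezinKernel_unitary hT.1.summable hT.1.defect_nonneg' hK U hU
    obtain ⟨σ, hσ, hσM⟩ := hM.exists_unitary hM' τ₂ fun x =>
      (norm_eq_iff_norm_adjoint_eq hn hn' _ x).mpr <|
        (congrArg norm (adjoint_apply_of_unitary U _ h₂ x)).trans (U.norm_map _)
    obtain ⟨τ₁, h₁⟩ := exists_berezinKernel_unitary hM.summable hM.defect_nonneg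
      hM.isBerezinKernel σ hσM
    exact coincide_of_unitary τ₁ τ₂ σ hσ h₁
  · rintro ⟨τ₁, τ₂, hτ⟩
    exact unitarilyEquivalent_of_norm_adjoint_eq (hT.berezinKernel_injective hm)
      (hT'.berezinKernel_injective hm) (hK.apply_adjoint hT.1.commute)
      (hK'.apply_adjoint hT'.1.commute) τ₂ fun x => (norm_eq_iff_norm_adjoint_eq hn hn' _ x).mp <|
        norm_eq_of_coincide hM.norm_berezinKernel hM'.norm_berezinKernel τ₁ τ₂ hτ x

end invariant

end Polydomain

end

theorem mainTheorem10 {k : ℕ} (hk : 1 ≤ k) {n m : Fin k → ℕ} (hn : ∀ i, 1 ≤ n i) (hm : ∀ i, 1 ≤ m i)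
    (f : ∀ i, Polydomain.PositiveRegular (n i))
    {H : Type*} [NormedAddCommGroup H] [InnerProductSpace ℂ H] [CompleteSpace H]
    {H' : Type*} [NormedAddCommGroup H'] [InnerProductSpace ℂ H'] [CompleteSpace H']
    (T : Polydomain.OpTuple n H) (T' : Polydomain.OpTuple n H')
    (hT : Polydomain.HasCharacteristicFunction f m T)
    (hT' : Polydomain.HasCharacteristicFunction f m T')
    (hTc : Polydomain.CompletelyNonCoisometric f m T)
    (hTc' : Polydomain.CompletelyNonCoisometric f m T') :
    Polydomain.UnitarilyEquivalent T T' ↔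
      Polydomain.Coincide (Polydomain.characteristicFunction f m T)
        (Polydomain.characteristicFunction f m T') := by
  exact Polydomain.unitarilyEquivalent_iff_coincide hm hTc hTc'
    (Polydomain.adjoint_sqrtRange hT.complementary_nonneg)
    (Polydomain.adjoint_sqrtRange hT'.complementary_nonneg)
    (Polydomain.adjoint_sqrtRange_comp hT.complementary_nonneg)
    (Polydomain.adjoint_sqrtRange_comp hT'.complementary_nonneg)
    (hT.isIsometricModel hm) (hT'.isIsometricModel hm)
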